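/- Let $k$ be a commutative $\mathbb{Q}$-algebra (for example a field of characteristic zero), let $V=V_0\oplus V_1$ be a $\mathbb{Z}_2$-graded $k$-module, and let $W=\Pi V$ be its parity reversion. Let $\bigodot W=\bigoplus_{n\ge 1}\bigodot^n W$ be the reduced symmetric coalgebra of $W$ (graded by parity, with the reduced unshuffle diagonal $\Delta$). An $L_\infty$ algebra structure on $V$ is an odd codifferential $d$ on $\bigodot W$, i.e. an odd coderivation with $d^2=0$. Let $l:\bigodot W\to W$ be the cochain given by the degree-one component of $d$. The cochains are $C(V):=\operatorname{Hom}(\bigodot W,W)$; each cochain $\varphi$ extends to $\bigodot W$ by $$\hat\varphi(w_1\odot\cdots\odot w_n)=\sum_{1\le p\le n}\ \sum_{\sigma\in \mathrm{Sh}(p,n-p)}\epsilon(\sigma)\,\varphi(w_{\sigma(1)}\odot\cdots\odot w_{\sigma(p)})\odot w_{\sigma(p+1)}\odot\cdots\odot w_{\sigma(n)},$$ where $\epsilon(\sigma)$ is the Koszul sign, and for homogeneous cochains $[\varphi,\psi]=\varphi\circ\hat\psi-(-1)^{|\varphi||\psi|}\psi\circ\hat\varphi$. Put $D(\varphi)=[\varphi,l]$.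 Then $D$ is an odd map with $D^2=0$; let $H(V)=\ker D/\operatorname{im}D=H(V)_0\oplus H(V)_1$ be its cohomology. It classifies the infinitesimal deformations in the following sense. Let $t$ be a parameter of parity $s\in\mathbb{Z}_2$ with $t^2=0$ and $xt=(-1)^{s|x|}tx$. An infinitesimal deformation of $d$ (with parameter $t$) is an odd codifferential on the coalgebra $\bigodot W[t]$ over $k[t]$ which reduces to $d$ modulo $t$; it is trivial if an automorphism (even, $k[t]$-linear) of the graded coalgebra $\bigodot W[t]$ takes $d$ to it. For each $s$: 1. every infinitesimal deformation is $d+t\hat\delta$ for a unique cochain $\delta\in C(V)$ of parity $s+1$; and for $\delta$ of parity $s+1$, $d+t\hat\delta$ is an infinitesimal deformation if and only if $D(\delta)=0$; 2. for $\delta$ of parity $s+1$, $d+t\hat\delta$ is trivial if and only if $\delta$ is a coboundary, i.e. $\delta=D(\lambda)$ for a cochain $\lambda$ of parity $s$; 3. $d+t\hat\delta\mapsto[\delta]$ induces a bijection from the infinitesimal deformations with parameter of parity $s$, modulo the automorphisms of the coalgebra $\bigodot W[t]$ that are the identity modulo $t$, to $H(V)_{s+1}$. -/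

import Mathlib

open scoped TensorProduct

namespace LInfinity

noncomputable section

/-! ### Graded modules

A `ℤ₂`-graded `k`-module is a module `W` with submodules `𝒲 0` (even) and `𝒲 1` (odd) such that
`W = 𝒲 0 ⊕ 𝒲 1`. -/

section Graded

variable {k : Type*} [CommRing k] {W : Type*} [AddCommGroup W] [Module k W]

/-- The sign `(-1)^(ab)` of two parities. -/
def sgn (k : Type*) [CommRing k] (a b : ZMod 2) : k := (-1) ^ (a.val * b.val)

/-- The parity reversion `ΠV`: the same module, with the parity of the elements reversed. -/
def parityRev (𝒱 : ZMod 2 → Submodule k W) : ZMod 2 → Submodule k W := fun i => 𝒱 (i + 1)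

/-- The projection to the component of parity `i`. -/
def proj (𝒲 : ZMod 2 → Submodule k W) [DirectSum.Decomposition 𝒲] (i : ZMod 2) : W →ₗ[k] W :=
  (𝒲 i).subtype ∘ₗ DirectSum.component k (ZMod 2) (fun j => 𝒲 j) i ∘ₗ
    (DirectSum.decomposeLinearEquiv 𝒲).toLinearMap

theorem proj_same (𝒲 : ZMod 2 → Submodule k W) [DirectSum.Decomposition 𝒲] {i : ZMod 2} {x : W}
    (hx : x ∈ 𝒲 i) : proj 𝒲 i x = x :=
  DirectSum.decompose_of_mem_same 𝒲 hx

theorem proj_ne (𝒲 : ZMod 2 → Submodule k W) [DirectSum.Decomposition 𝒲] {i j : ZMod 2} {x : W}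
    (hx : x ∈ 𝒲 i) (hij : i ≠ j) : proj 𝒲 j x = 0 :=
  DirectSum.decompose_of_mem_ne 𝒲 hx hij

theorem zmod_two_cases (i : ZMod 2) : i = 0 ∨ i = 1 := by
  revert i; decide

theorem proj_add_proj (𝒲 : ZMod 2 → Submodule k W) [DirectSum.Decomposition 𝒲] (x : W) :
    proj 𝒲 0 x + proj 𝒲 1 x = x := by
  induction x using DirectSum.Decomposition.inductionOn 𝒲 with
  | zero => simp
  | @homogeneous i m =>
    rcases zmod_two_cases i with rfl | rfl
    · rw [proj_same 𝒲 m.2, proj_ne 𝒲 m.2 (by decide), add_zero]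
    · rw [proj_same 𝒲 m.2, proj_ne 𝒲 m.2 (by decide), zero_add]
  | add m n hm hn => rw [map_add, map_add, add_add_add_comm, hm, hn]

theorem proj_mem (𝒲 : ZMod 2 → Submodule k W) [DirectSum.Decomposition 𝒲] (i : ZMod 2) (x : W) :
    proj 𝒲 i x ∈ 𝒲 i :=
  (DirectSum.decompose 𝒲 x i).2

/-- The decomposition of `x` with respect to the reversed parity. -/
def parityRevDecompose (𝒱 : ZMod 2 → Submodule k W) [DirectSum.Decomposition 𝒱] (x : W) :
    DirectSum (ZMod 2) fun i => parityRev 𝒱 i :=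
  DirectSum.of (fun i => parityRev 𝒱 i) 0 ⟨proj 𝒱 1 x, proj_mem 𝒱 1 x⟩ +
    DirectSum.of (fun i => parityRev 𝒱 i) 1 ⟨proj 𝒱 0 x, proj_mem 𝒱 0 x⟩

instance parityRevDecomposition (𝒱 : ZMod 2 → Submodule k W) [DirectSum.Decomposition 𝒱] :
    DirectSum.Decomposition (parityRev 𝒱) where
  decompose' := parityRevDecompose 𝒱
  left_inv x := by
    rw [parityRevDecompose, map_add, DirectSum.coeAddMonoidHom_of, DirectSum.coeAddMonoidHom_of]
    exact (add_comm _ _).trans (proj_add_proj 𝒱 x)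
  right_inv y := by
    induction y using DirectSum.induction_on with
    | zero =>
      rw [map_zero, parityRevDecompose]
      simp only [map_zero]
      exact (congrArg₂ (· + ·) (map_zero _) (map_zero _)).trans (add_zero 0)
    | of i m =>
      have hm : (m : W) ∈ 𝒱 (i + 1) := m.2
      rw [DirectSum.coeAddMonoidHom_of, parityRevDecompose]
      rcases zmod_two_cases i with rfl | rfl
      · have h1 : (⟨proj 𝒱 1 m, proj_mem 𝒱 1 m⟩ : parityRev 𝒱 0) = m :=
          Subtype.ext (proj_same 𝒱 (i := 1) hm)
        have h0 : (⟨proj 𝒱 0 m, proj_mem 𝒱 0 m⟩ : parityRev 𝒱 1) = 0 :=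
          Subtype.ext (proj_ne 𝒱 (i := 1) hm (by decide))
        rw [h1, h0, map_zero, add_zero]
      · have h1 : (⟨proj 𝒱 1 m, proj_mem 𝒱 1 m⟩ : parityRev 𝒱 0) = 0 :=
          Subtype.ext (proj_ne 𝒱 (i := 0) hm (by decide))
        have h0 : (⟨proj 𝒱 0 m, proj_mem 𝒱 0 m⟩ : parityRev 𝒱 1) = m :=
          Subtype.ext (proj_same 𝒱 (i := 0) hm)
        rw [h1, h0, map_zero, zero_add]
    | add a b ha hb =>
      rw [map_add]
      conv_rhs => rw [← ha, ← hb]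
      have e0 : ∀ u v : W, (⟨proj 𝒱 1 (u + v), proj_mem 𝒱 1 (u + v)⟩ : parityRev 𝒱 0) =
          ⟨proj 𝒱 1 u, proj_mem 𝒱 1 u⟩ + ⟨proj 𝒱 1 v, proj_mem 𝒱 1 v⟩ :=
        fun u v => Subtype.ext (map_add _ _ _)
      have e1 : ∀ u v : W, (⟨proj 𝒱 0 (u + v), proj_mem 𝒱 0 (u + v)⟩ : parityRev 𝒱 1) =
          ⟨proj 𝒱 0 u, proj_mem 𝒱 0 u⟩ + ⟨proj 𝒱 0 v, proj_mem 𝒱 0 v⟩ :=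
        fun u v => Subtype.ext (map_add _ _ _)
      rw [parityRevDecompose, e0, e1, map_add, map_add, parityRevDecompose, parityRevDecompose]
      abel

/-- A linear map is homogeneous of parity `p`. -/
def HasParity {k X Y : Type*} [Semiring k] [AddCommMonoid X] [Module k X] [AddCommMonoid Y]
    [Module k Y] (𝒳 : ZMod 2 → Submodule k X) (𝒴 : ZMod 2 → Submodule k Y) (p : ZMod 2)
    (f : X →ₗ[k] Y) : Prop :=
  ∀ i, ∀ x ∈ 𝒳 i, f x ∈ 𝒴 (i + p)

end Graded

/-! ### The symmetric coalgebra -/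

section Symmetric

variable {k : Type*} [CommRing k] {W : Type*} [AddCommGroup W] [Module k W]

/-- The relations `u ⊗ v = (-1)^(uv) v ⊗ u` for homogeneous `u`, `v`. -/
inductive SymRel (𝒲 : ZMod 2 → Submodule k W) : TensorAlgebra k W → TensorAlgebra k W → Prop
  | comm (i j : ZMod 2) (u v : W) (hu : u ∈ 𝒲 i) (hv : v ∈ 𝒲 j) :
      SymRel 𝒲 (TensorAlgebra.ι k u * TensorAlgebra.ι k v)
        (sgn k i j • (TensorAlgebra.ι k v * TensorAlgebra.ι k u))

/-- The unital graded symmetric algebra `k ⊕ W ⊕ W ⊙ W ⊕ ⋯`; its product is `⊙`. -/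
def SymAlg (𝒲 : ZMod 2 → Submodule k W) : Type _ := RingQuot (SymRel 𝒲)

instance (𝒲 : ZMod 2 → Submodule k W) : Ring (SymAlg 𝒲) :=
  inferInstanceAs (Ring (RingQuot (SymRel 𝒲)))

instance (𝒲 : ZMod 2 → Submodule k W) : Algebra k (SymAlg 𝒲) :=
  inferInstanceAs (Algebra k (RingQuot (SymRel 𝒲)))

/-- The quotient map from the tensor algebra. -/
def mkSym (𝒲 : ZMod 2 → Submodule k W) : TensorAlgebra k W →ₐ[k] SymAlg 𝒲 :=
  RingQuot.mkAlgHom k (SymRel 𝒲)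

variable (𝒲 : ZMod 2 → Submodule k W)

/-- The inclusion of `W` in the symmetric algebra. -/
def ι : W →ₗ[k] SymAlg 𝒲 :=
  (mkSym 𝒲).toLinearMap ∘ₗ TensorAlgebra.ι k

variable {𝒲} in
theorem ι_comm {i j : ZMod 2} {u v : W} (hu : u ∈ 𝒲 i) (hv : v ∈ 𝒲 j) :
    ι 𝒲 u * ι 𝒲 v = sgn k i j • (ι 𝒲 v * ι 𝒲 u) := by
  have h : mkSym 𝒲 _ = mkSym 𝒲 _ :=
    RingQuot.mkAlgHom_rel k (SymRel.comm (𝒲 := 𝒲) i j u v hu hv)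
  rw [map_mul, map_smul, map_mul] at h
  exact h

/-- The universal property of the symmetric algebra. -/
def lift {A : Type*} [Ring A] [Algebra k A] (f : W →ₗ[k] A)
    (hf : ∀ i j : ZMod 2, ∀ u ∈ 𝒲 i, ∀ v ∈ 𝒲 j, f u * f v = sgn k i j • (f v * f u)) :
    SymAlg 𝒲 →ₐ[k] A :=
  RingQuot.liftAlgHom k ⟨TensorAlgebra.lift k f, by
    rintro _ _ ⟨i, j, u, v, hu, hv⟩
    simpa using hf i j u hu v hv⟩

theorem lift_ι {A : Type*} [Ring A] [Algebra k A] (f : W →ₗ[k] A)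
    (hf : ∀ i j : ZMod 2, ∀ u ∈ 𝒲 i, ∀ v ∈ 𝒲 j, f u * f v = sgn k i j • (f v * f u)) (w : W) :
    lift 𝒲 f hf (ι 𝒲 w) = f w := by
  have h := RingQuot.liftAlgHom_mkAlgHom_apply k (TensorAlgebra.lift k f)
    (s := SymRel 𝒲) (by
      rintro _ _ ⟨i, j, u, v, hu, hv⟩
      simpa using hf i j u hu v hv) (TensorAlgebra.ι k w)
  rw [TensorAlgebra.lift_ι_apply] at h
  exact h

/-- The augmentation `⊙W → k`, which kills `W`. -/
def aug : SymAlg 𝒲 →ₐ[k] k := lift 𝒲 0 (by simp)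

/-- The (reduced) symmetric coalgebra `⊙W = ⨁_{n ≥ 1} ⊙ⁿ W`, as the augmentation ideal of the
unital symmetric algebra. -/
def Sym : Type _ := LinearMap.ker (aug 𝒲).toLinearMap

instance : AddCommGroup (Sym 𝒲) :=
  inferInstanceAs (AddCommGroup (LinearMap.ker (aug 𝒲).toLinearMap))

instance : Module k (Sym 𝒲) :=
  inferInstanceAs (Module k (LinearMap.ker (aug 𝒲).toLinearMap))

/-- The inclusion of `⊙W` in the unital symmetric algebra. -/
def incl : Sym 𝒲 →ₗ[k] SymAlg 𝒲 := (LinearMap.ker (aug 𝒲).toLinearMap).subtype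

/-- The projection of the unital symmetric algebra to `⊙W`, with kernel `k`. -/
def toSym : SymAlg 𝒲 →ₗ[k] Sym 𝒲 :=
  (LinearMap.id - Algebra.linearMap k (SymAlg 𝒲) ∘ₗ (aug 𝒲).toLinearMap).codRestrict
    (LinearMap.ker (aug 𝒲).toLinearMap) (fun x => by simp)

theorem incl_toSym (x : SymAlg 𝒲) :
    incl 𝒲 (toSym 𝒲 x) = x - algebraMap k (SymAlg 𝒲) (aug 𝒲 x) := rfl

theorem toSym_incl (x : Sym 𝒲) : toSym 𝒲 (incl 𝒲 x) = x := by
  have h : aug 𝒲 (incl 𝒲 x) = 0 := x.2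
  apply Subtype.ext
  change incl 𝒲 (toSym 𝒲 (incl 𝒲 x)) = incl 𝒲 x
  rw [incl_toSym, h, map_zero, sub_zero]

/-- The elements of parity `i` of `⊙W`: the span of the products `v₁ ⊙ ⋯ ⊙ vₙ` of homogeneous
elements whose parities add up to `i`. -/
def symGrading (i : ZMod 2) : Submodule k (Sym 𝒲) :=
  (Submodule.span k {x : SymAlg 𝒲 | ∃ (n : ℕ) (p : Fin n → ZMod 2) (v : Fin n → W),
    (∀ j, v j ∈ 𝒲 (p j)) ∧ ∑ j, p j = i ∧ x = (List.ofFn fun j => ι 𝒲 (v j)).prod}).comap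
    (incl 𝒲)

/-- The representation of the symmetric algebra on `k ⊕ W` in which `w ∈ W` acts by
`(c, x) ↦ (0, c w)`. -/
def degreeOneRep : SymAlg 𝒲 →ₐ[k] Module.End k (k × W) :=
  lift 𝒲
    { toFun := fun w => LinearMap.inr k k W ∘ₗ (LinearMap.fst k k W).smulRight w
      map_add' := fun a b => by ext <;> simp
      map_smul' := fun c a => by ext <;> simp }
    (fun i j u _ v _ => by ext <;> simp)

/-- The projection `⊙W → W` to the component of degree one: the products `v₁ ⊙ ⋯ ⊙ vₙ` with
`n ≥ 2` act by zero in `degreeOneRep`, and `w ∈ W` sends `(1, 0)` to `(0, w)`. -/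
def toW : Sym 𝒲 →ₗ[k] W :=
  LinearMap.snd k k W ∘ₗ LinearMap.applyₗ ((1, 0) : k × W) ∘ₗ
    (degreeOneRep 𝒲).toLinearMap ∘ₗ incl 𝒲

theorem toW_apply (x : Sym 𝒲) : toW 𝒲 x = (degreeOneRep 𝒲 (incl 𝒲 x) (1, 0)).2 := rfl

variable [DirectSum.Decomposition 𝒲]

theorem sign_W {i : ZMod 2} {u : W} (hu : u ∈ 𝒲 i) :
    proj 𝒲 0 u - proj 𝒲 1 u = sgn k i 1 • u := by
  rcases zmod_two_cases i with rfl | rfl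
  · rw [proj_same 𝒲 hu, proj_ne 𝒲 hu (by decide)]
    simp [sgn]
  · rw [proj_same 𝒲 hu, proj_ne 𝒲 hu (by decide)]
    simp [sgn, ZMod.val_one]

/-- The parity automorphism `x ↦ (-1)^x x` of the symmetric algebra. -/
def parityAut : SymAlg 𝒲 →ₐ[k] SymAlg 𝒲 :=
  lift 𝒲 (ι 𝒲 ∘ₗ (proj 𝒲 0 - proj 𝒲 1)) (fun i j u hu v hv => by
    simp only [LinearMap.comp_apply, LinearMap.sub_apply, sign_W 𝒲 hu, sign_W 𝒲 hv, map_smul,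
      smul_mul_smul_comm, ι_comm hu hv]
    simp only [smul_smul]
    congr 1
    ring)

/-- The parity automorphism `x ↦ (-1)^x x` of `⊙W`. -/
def symSign : Module.End k (Sym 𝒲) :=
  toSym 𝒲 ∘ₗ (parityAut 𝒲).toLinearMap ∘ₗ incl 𝒲

/-- Left multiplication by `w ⊗ 1 + 1 ⊗ w` on the graded tensor product of two copies of the
symmetric algebra: `a ⊗ b ↦ w a ⊗ b + (-1)^(w a) a ⊗ w b`. -/
def mulPrim : W →ₗ[k] Module.End k (SymAlg 𝒲 ⊗[k] SymAlg 𝒲) :=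
  (TensorProduct.mapBilinear (.id k) (SymAlg 𝒲) (SymAlg 𝒲) (SymAlg 𝒲) (SymAlg 𝒲)).flip
      LinearMap.id ∘ₗ LinearMap.mul k (SymAlg 𝒲) ∘ₗ ι 𝒲 +
    TensorProduct.mapBilinear (.id k) (SymAlg 𝒲) (SymAlg 𝒲) (SymAlg 𝒲) (SymAlg 𝒲)
      LinearMap.id ∘ₗ LinearMap.mul k (SymAlg 𝒲) ∘ₗ ι 𝒲 ∘ₗ proj 𝒲 0 +
    TensorProduct.mapBilinear (.id k) (SymAlg 𝒲) (SymAlg 𝒲) (SymAlg 𝒲) (SymAlg 𝒲)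
      (parityAut 𝒲).toLinearMap ∘ₗ LinearMap.mul k (SymAlg 𝒲) ∘ₗ ι 𝒲 ∘ₗ proj 𝒲 1

theorem mulPrim_tmul (w : W) (a b : SymAlg 𝒲) :
    mulPrim 𝒲 w (a ⊗ₜ b) = (ι 𝒲 w * a) ⊗ₜ b + a ⊗ₜ (ι 𝒲 (proj 𝒲 0 w) * b) +
      parityAut 𝒲 a ⊗ₜ (ι 𝒲 (proj 𝒲 1 w) * b) := by
  simp [mulPrim]

/-- For `w` of parity `i`, the operator `mulPrim w` is `a ⊗ b ↦ w a ⊗ b + (-1)^(i a) a ⊗ w b`. -/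
theorem mulPrim_tmul_of_mem {i : ZMod 2} {w : W} (hw : w ∈ 𝒲 i) (a b : SymAlg 𝒲) :
    mulPrim 𝒲 w (a ⊗ₜ b) =
      (ι 𝒲 w * a) ⊗ₜ b + ((parityAut 𝒲).toLinearMap ^ i.val) a ⊗ₜ (ι 𝒲 w * b) := by
  rcases zmod_two_cases i with rfl | rfl
  · simp [mulPrim_tmul, proj_same 𝒲 hw, proj_ne 𝒲 hw (show (0 : ZMod 2) ≠ 1 by decide)]
  · simp [mulPrim_tmul, proj_same 𝒲 hw, proj_ne 𝒲 hw (show (1 : ZMod 2) ≠ 0 by decide),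
      ZMod.val_one]

theorem parityAut_ι {i : ZMod 2} {w : W} (hw : w ∈ 𝒲 i) :
    parityAut 𝒲 (ι 𝒲 w) = sgn k i 1 • ι 𝒲 w := by
  rw [parityAut, lift_ι, LinearMap.comp_apply, LinearMap.sub_apply, sign_W 𝒲 hw, map_smul]

theorem mulPrim_comm (i j : ZMod 2) (u : W) (hu : u ∈ 𝒲 i) (v : W) (hv : v ∈ 𝒲 j) :
    mulPrim 𝒲 u * mulPrim 𝒲 v = sgn k i j • (mulPrim 𝒲 v * mulPrim 𝒲 u) := by
  ext a b
  have h : ι 𝒲 u * ι 𝒲 v = sgn k i j • (ι 𝒲 v * ι 𝒲 u) := ι_comm hu hv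
  have hb := congrArg (· * b) h
  have ha := congrArg (· * a) h
  simp only [mul_assoc, smul_mul_assoc] at ha hb
  have hpu := parityAut_ι 𝒲 hu
  have hpv := parityAut_ι 𝒲 hv
  simp only [TensorProduct.AlgebraTensorModule.curry_apply, LinearMap.restrictScalars_self,
    TensorProduct.curry_apply, Module.End.mul_apply, LinearMap.smul_apply,
    mulPrim_tmul_of_mem 𝒲 hu, mulPrim_tmul_of_mem 𝒲 hv, map_add]
  rcases zmod_two_cases i with rfl | rfl <;> rcases zmod_two_cases j with rfl | rfl <;>
  · simp [sgn, ZMod.val_one] at ha hb hpu hpv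
    simp [sgn, ZMod.val_one, hpu, hpv, ha, hb, TensorProduct.tmul_neg, TensorProduct.neg_tmul]
    abel

/-- The full diagonal of the unital symmetric algebra: the multiplicative map to the graded tensor
product with `w ↦ w ⊗ 1 + 1 ⊗ w`. It sends `v₁ ⊙ ⋯ ⊙ vₙ` to the sum over `0 ≤ p ≤ n` and over
the unshuffles `σ` of type `(p, n - p)` of
`ε(σ) v_σ(1) ⊙ ⋯ ⊙ v_σ(p) ⊗ v_σ(p+1) ⊙ ⋯ ⊙ v_σ(n)`. -/
def fullDiagonal : SymAlg 𝒲 →ₗ[k] SymAlg 𝒲 ⊗[k] SymAlg 𝒲 :=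
  LinearMap.applyₗ ((1 : SymAlg 𝒲) ⊗ₜ[k] (1 : SymAlg 𝒲)) ∘ₗ (lift 𝒲 (mulPrim 𝒲) (mulPrim_comm 𝒲)).toLinearMap

theorem fullDiagonal_one : fullDiagonal 𝒲 1 = 1 ⊗ₜ 1 := by
  simp [fullDiagonal]

theorem fullDiagonal_ι_mul (w : W) (x : SymAlg 𝒲) :
    fullDiagonal 𝒲 (ι 𝒲 w * x) = mulPrim 𝒲 w (fullDiagonal 𝒲 x) := by
  simp [fullDiagonal, lift_ι]

/-- The reduced diagonal of the symmetric coalgebra `⊙W`: the terms `1 ≤ p ≤ n - 1` of the full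
diagonal. -/
def diagonal : Sym 𝒲 →ₗ[k] Sym 𝒲 ⊗[k] Sym 𝒲 :=
  TensorProduct.map (toSym 𝒲) (toSym 𝒲) ∘ₗ fullDiagonal 𝒲 ∘ₗ incl 𝒲

/-- A coderivation of parity `p` of `⊙W` with respect to the `ℤ₂`-grading: a homogeneous map with
`Δ ∘ F = (F ⊗ 1 + 1 ⊗ F) ∘ Δ`, where `(1 ⊗ F)(a ⊗ b) = (-1)^(a p) a ⊗ F b`. -/
structure IsCoderivation (p : ZMod 2) (F : Sym 𝒲 →ₗ[k] Sym 𝒲) : Prop where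
  parity : HasParity (symGrading 𝒲) (symGrading 𝒲) p F
  diagonal_comp : diagonal 𝒲 ∘ₗ F =
    (TensorProduct.map F LinearMap.id + TensorProduct.map (symSign 𝒲 ^ p.val) F) ∘ₗ diagonal 𝒲

/-! ### Cochains -/

/-- The cochains `C(W) = Hom(⊙W, W)`. -/
abbrev Cochain : Type _ := Sym 𝒲 →ₗ[k] W

/-- The submodule `C(W)_p` of the cochains of parity `p`. -/
def cochains (p : ZMod 2) : Submodule k (Cochain 𝒲) where
  carrier := {φ | HasParity (symGrading 𝒲) 𝒲 p φ}
  add_mem' hφ hψ i x hx := add_mem (hφ i x hx) (hψ i x hx)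
  zero_mem' _ _ _ := zero_mem _
  smul_mem' c _ hφ i x hx := (𝒲 (i + p)).smul_mem c (hφ i x hx)

/-- The extension `φ̂` of a cochain `φ` to `⊙W`: it sends `v₁ ⊙ ⋯ ⊙ vₙ` to the sum over
`1 ≤ p ≤ n` and over the unshuffles `σ` of type `(p, n - p)` of
`ε(σ) φ(v_σ(1) ⊙ ⋯ ⊙ v_σ(p)) ⊙ v_σ(p+1) ⊙ ⋯ ⊙ v_σ(n)`. -/
def extend : Cochain 𝒲 →ₗ[k] Sym 𝒲 →ₗ[k] Sym 𝒲 where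
  toFun φ := toSym 𝒲 ∘ₗ LinearMap.mul' k (SymAlg 𝒲) ∘ₗ
    TensorProduct.map (ι 𝒲 ∘ₗ φ ∘ₗ toSym 𝒲) LinearMap.id ∘ₗ fullDiagonal 𝒲 ∘ₗ incl 𝒲
  map_add' φ ψ := by
    simp only [LinearMap.add_comp, LinearMap.comp_add, TensorProduct.map_add_left]
  map_smul' c φ := by
    simp only [LinearMap.smul_comp, LinearMap.comp_smul, TensorProduct.map_smul_left,
      RingHom.id_apply]

/-- The bracket `[φ, ψ] = φ ∘ ψ̂ - (-1)^(pq) ψ ∘ φ̂` of cochains of parities `p` and `q`, which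
is the bracket of the coderivations `φ̂` and `ψ̂`. -/
def bracket (p q : ZMod 2) (φ ψ : Cochain 𝒲) : Cochain 𝒲 :=
  φ ∘ₗ extend 𝒲 ψ - sgn k p q • (ψ ∘ₗ extend 𝒲 φ)

end Symmetric

/-! ### `L∞` algebras and their cohomology -/

section Cohomology

variable {k : Type*} [CommRing k] {V : Type*} [AddCommGroup V] [Module k V]

/-- An `L∞` algebra structure on `V`: an odd codifferential on the symmetric coalgebra of `ΠV`. -/
structure LInfinityStructure (𝒱 : ZMod 2 → Submodule k V) [DirectSum.Decomposition 𝒱] where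
  /-- The codifferential. -/
  d : Sym (parityRev 𝒱) →ₗ[k] Sym (parityRev 𝒱)
  isCoderivation : IsCoderivation (parityRev 𝒱) 1 d
  comp_self : d ∘ₗ d = 0

variable {𝒱 : ZMod 2 → Submodule k V} [DirectSum.Decomposition 𝒱] (L : LInfinityStructure 𝒱)

namespace LInfinityStructure

/-- The cochain `l : ⊙ΠV → ΠV` that is induced by the codifferential; its restrictions to the
`⊙ⁿΠV` are the structure maps of the `L∞` algebra. -/
def l : Cochain (parityRev 𝒱) := toW (parityRev 𝒱) ∘ₗ L.d

/-- The coboundary `D(φ) = [φ, l]` of the cochains `φ` of parity `p`. -/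
def D (p : ZMod 2) : Cochain (parityRev 𝒱) →ₗ[k] Cochain (parityRev 𝒱) where
  toFun φ := bracket (parityRev 𝒱) p 1 φ L.l
  map_add' φ ψ := by
    simp only [bracket, map_add, LinearMap.add_comp, LinearMap.comp_add, smul_add]
    abel
  map_smul' c φ := by
    simp only [bracket, map_smul, LinearMap.smul_comp, LinearMap.comp_smul, smul_sub,
      RingHom.id_apply, smul_comm c]

/-- The cocycles of parity `p`. -/
def cocycles (p : ZMod 2) : Submodule k (Cochain (parityRev 𝒱)) :=
  cochains (parityRev 𝒱) p ⊓ LinearMap.ker (L.D p)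

/-- The coboundaries of parity `p`: the `D(φ)` with `φ` of parity `p + 1`. -/
def coboundaries (p : ZMod 2) : Submodule k (Cochain (parityRev 𝒱)) :=
  (cochains (parityRev 𝒱) (p + 1)).map (L.D (p + 1))

/-- The part of parity `p` of the cohomology `H(V)`. -/
abbrev H (p : ZMod 2) : Type _ := L.cocycles p ⧸ (L.coboundaries p).submoduleOf (L.cocycles p)

end LInfinityStructure

end Cohomology

/-! ### Infinitesimal deformations

`t` is a parameter of parity `s` with `t² = 0` and `x t = (-1)^(s x) t x`. An element `a + t b` of
`X[t] = X ⊕ t X` is written as the pair `(a, b)`. -/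

section Deformation

variable {k : Type*} [CommRing k] {W : Type*} [AddCommGroup W] [Module k W]

/-- Multiplication by `t` on `X[t]`: `t (a + t b) = t a`. -/
def tMul (k X : Type*) [CommRing k] [AddCommMonoid X] [Module k X] : X × X →ₗ[k] X × X :=
  LinearMap.inr k X X ∘ₗ LinearMap.fst k X X

/-- The grading of `X[t]`, for `t` of parity `s`: the parity of `t b` is that of `b` plus `s`. -/
def tGrading {X : Type*} [AddCommMonoid X] [Module k X] (s : ZMod 2) (𝒳 : ZMod 2 → Submodule k X)
    (i : ZMod 2) : Submodule k (X × X) :=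
  (𝒳 i).prod (𝒳 (i + s))

/-- The operator `f + t g` on `X[t]`, for `f` odd and `t` of parity `s`:
`(f + t g)(a + t b) = f a + t (g a + (-1)^s f b)`. -/
def tOdd {X : Type*} [AddCommMonoid X] [Module k X] (s : ZMod 2) (f g : X →ₗ[k] X) :
    X × X →ₗ[k] X × X :=
  (f ∘ₗ LinearMap.fst k X X).prod
    (g ∘ₗ LinearMap.fst k X X + sgn k s 1 • (f ∘ₗ LinearMap.snd k X X))

variable (𝒲 : ZMod 2 → Submodule k W) [DirectSum.Decomposition 𝒲]

/-- The coalgebra `⊙W[t]` over `k[t]`. -/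
abbrev SymT : Type _ := Sym 𝒲 × Sym 𝒲

/-- `⊙W[t] ⊗_{k[t]} ⊙W[t]`, identified with `(⊙W ⊗ ⊙W)[t]`. -/
abbrev SymTensorT : Type _ := (Sym 𝒲 ⊗[k] Sym 𝒲) × (Sym 𝒲 ⊗[k] Sym 𝒲)

/-- The diagonal of `⊙W[t]`, which extends the diagonal of `⊙W` linearly over `k[t]`. -/
def diagonalT : SymT 𝒲 →ₗ[k] SymTensorT 𝒲 :=
  (diagonal 𝒲).prodMap (diagonal 𝒲)

/-- The product `x, y ↦ x ⊗ y` of elements of `⊙W[t]`, for `t` of parity `s`: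
`(a + t b) ⊗ (a' + t b') = a ⊗ a' + t (b ⊗ a' + (-1)^(s a) a ⊗ b')`. -/
def tmulT (s : ZMod 2) : SymT 𝒲 →ₗ[k] SymT 𝒲 →ₗ[k] SymTensorT 𝒲 :=
  LinearMap.mk₂ k
    (fun x y => (x.1 ⊗ₜ[k] y.1, x.2 ⊗ₜ[k] y.1 + (symSign 𝒲 ^ s.val) x.1 ⊗ₜ[k] y.2))
    (fun x x' y => by
      ext1
      · simp [TensorProduct.add_tmul]
      · simp only [Prod.fst_add, Prod.snd_add, map_add, TensorProduct.add_tmul]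
        abel)
    (fun c x y => by
      ext1
      · simp [TensorProduct.smul_tmul']
      · simp [TensorProduct.smul_tmul'])
    (fun x y y' => by
      ext1
      · simp [TensorProduct.tmul_add]
      · simp only [Prod.fst_add, Prod.snd_add, TensorProduct.tmul_add]
        abel)
    (fun c x y => by
      ext1
      · simp
      · simp)

/-- `F ⊗ G : ⊙W ⊗ ⊙W → ⊙W[t] ⊗_{k[t]} ⊙W[t]`, `a ⊗ b ↦ F(a) ⊗ G(b)`, with no sign. -/
def mapT (s : ZMod 2) (F G : SymT 𝒲 →ₗ[k] SymT 𝒲) : Sym 𝒲 ⊗[k] Sym 𝒲 →ₗ[k] SymTensorT 𝒲 :=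
  TensorProduct.lift ((tmulT 𝒲 s).compl₁₂ (F ∘ₗ LinearMap.inl k _ _) (G ∘ₗ LinearMap.inl k _ _))

/-- The parity automorphism `x ↦ (-1)^x x` of `⊙W[t]`, for `t` of parity `s`. -/
def signT (s : ZMod 2) : SymT 𝒲 →ₗ[k] SymT 𝒲 :=
  (symSign 𝒲).prodMap (sgn k s 1 • symSign 𝒲)

/-- An odd codifferential on the coalgebra `⊙W[t]` over `k[t]`, where `t` has parity `s`. By
linearity over `k[t]` the coderivation property is the one on the elements `(a, 0)` of `⊙W`. -/
structure IsOddCodifferentialT (s : ZMod 2) (F : SymT 𝒲 →ₗ[k] SymT 𝒲) : Prop where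
  parity : HasParity (tGrading s (symGrading 𝒲)) (tGrading s (symGrading 𝒲)) 1 F
  map_tMul : ∀ x, F (tMul k (Sym 𝒲) x) = sgn k s 1 • tMul k (Sym 𝒲) (F x)
  diagonal_comp : ∀ a : Sym 𝒲, diagonalT 𝒲 (F (a, 0)) =
    (mapT 𝒲 s F LinearMap.id + mapT 𝒲 s (signT 𝒲 s) F)
      (diagonal 𝒲 a)
  comp_self : F ∘ₗ F = 0

/-- An (even) automorphism of the graded coalgebra `⊙W[t]` over `k[t]`, where `t` has
parity `s`. -/
structure IsAutomorphismT (s : ZMod 2) (Φ : SymT 𝒲 →ₗ[k] SymT 𝒲) : Prop where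
  parity : HasParity (tGrading s (symGrading 𝒲)) (tGrading s (symGrading 𝒲)) 0 Φ
  map_tMul : ∀ x, Φ (tMul k (Sym 𝒲) x) = tMul k (Sym 𝒲) (Φ x)
  diagonal_comp : ∀ a : Sym 𝒲, diagonalT 𝒲 (Φ (a, 0)) = mapT 𝒲 s Φ Φ (diagonal 𝒲 a)
  bijective : Function.Bijective Φ

end Deformation

namespace LInfinityStructure

variable {k : Type*} [CommRing k] {V : Type*} [AddCommGroup V] [Module k V]
  {𝒱 : ZMod 2 → Submodule k V} [DirectSum.Decomposition 𝒱] (L : LInfinityStructure 𝒱)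

/-- An infinitesimal deformation of an `L∞` algebra, with a parameter `t` of parity `s`: an odd
codifferential on `⊙ΠV[t]` over `k[t]` that reduces to `d` modulo `t`. -/
structure IsInfinitesimalDeformation (s : ZMod 2)
    (F : SymT (parityRev 𝒱) →ₗ[k] SymT (parityRev 𝒱)) : Prop where
  isOddCodifferentialT : IsOddCodifferentialT (parityRev 𝒱) s F
  reduction : ∀ a, (F (a, 0)).1 = L.d a

/-- The operator `d + t δ̂` on `⊙ΠV[t]` given by a cochain `δ`, for `t` of parity `s`. -/
def deform (s : ZMod 2) (δ : Cochain (parityRev 𝒱)) :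
    SymT (parityRev 𝒱) →ₗ[k] SymT (parityRev 𝒱) :=
  tOdd s L.d (extend (parityRev 𝒱) δ)

/-- `F` is trivial: an automorphism of the coalgebra `⊙ΠV[t]` takes `d` to `F`. -/
def IsTrivialDeformation (s : ZMod 2) (F : SymT (parityRev 𝒱) →ₗ[k] SymT (parityRev 𝒱)) : Prop :=
  ∃ Φ, IsAutomorphismT (parityRev 𝒱) s Φ ∧ Φ ∘ₗ L.deform s 0 = F ∘ₗ Φ

end LInfinityStructure

/-- Two infinitesimal deformations `F` and `F'` are equivalent: an automorphism of the coalgebra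
`⊙W[t]` which is the identity modulo `t` takes `F` to `F'`. -/
def EquivalentDeformations {k : Type*} [CommRing k] {W : Type*} [AddCommGroup W] [Module k W]
    (𝒲 : ZMod 2 → Submodule k W) [DirectSum.Decomposition 𝒲] (s : ZMod 2)
    (F F' : SymT 𝒲 →ₗ[k] SymT 𝒲) : Prop :=
  ∃ Φ, IsAutomorphismT 𝒲 s Φ ∧ (∀ a, (Φ (a, 0)).1 = a) ∧ Φ ∘ₗ F = F' ∘ₗ Φ

end

end LInfinity

/-!
A coderivation of `⊙W` is determined by its component of degree one. Indeed the extension of the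
cochain `toW` multiplies the words of length `n` by `n`, so that it has no kernel when `⊙W` has no
torsion; and it sends `F x` to zero as soon as the coderivation `F` has no component of degree one
and kills the words shorter than `x`. Hence `φ ↦ φ̂` and `F ↦ toW ∘ F` are inverse to each
other, the bracket of cochains becomes the graded commutator of coderivations, and `D` becomes
`[-, d]`.

Over `k[t]` only the coefficients of `1` and `t` matter. The operator `d + t f` is an odd
codifferential if and only if `f` is a coderivation with `[f, d] = 0`. An automorphism has the form
`(1 + t f) e` with `e` an automorphism of `⊙W` and `f` a coderivation, and it takes `d + t g` to
`d + t g'` if and only if `e` commutes with `d` and `[f, d] = g' - e g e⁻¹`. For `e = 1` or `g = 0`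
the conjugation by `e` disappears, and what remains says that `g' - g` is a coboundary.
-/

namespace LInfinity

noncomputable section

/-! ### Signs and homogeneous operators -/

section Sign

variable (k : Type*) [CommRing k]

theorem sgn_zero_left (p : ZMod 2) : sgn k 0 p = 1 := by simp [sgn]

theorem sgn_zero_right (p : ZMod 2) : sgn k p 0 = 1 := by simp [sgn]

theorem sgn_one_one : sgn k 1 1 = -1 := by simp [sgn, ZMod.val_one]

theorem sgn_comm (p q : ZMod 2) : sgn k p q = sgn k q p := by rw [sgn, sgn, mul_comm]

theorem sgn_mul_self (p q : ZMod 2) : sgn k p q * sgn k p q = 1 := by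
  rw [sgn, ← mul_pow]; simp

theorem sgn_add_left (p q r : ZMod 2) : sgn k (p + q) r = sgn k p r * sgn k q r := by
  rcases zmod_two_cases p with rfl | rfl
  · rw [zero_add, sgn_zero_left, one_mul]
  rcases zmod_two_cases q with rfl | rfl
  · rw [add_zero, sgn_zero_left, mul_one]
  · rw [sgn_mul_self, CharTwo.add_self_eq_zero, sgn_zero_left]

theorem sgn_add_right (p q r : ZMod 2) : sgn k p (q + r) = sgn k p q * sgn k p r := by
  simp only [sgn_comm k p, sgn_add_left]

end Sign

section Parity

variable {k X Y Z : Type*} [CommRing k] [AddCommGroup X] [Module k X] [AddCommGroup Y] [Module k Y]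
  [AddCommGroup Z] [Module k Z] {𝒳 : ZMod 2 → Submodule k X} {𝒴 : ZMod 2 → Submodule k Y}
  {𝒵 : ZMod 2 → Submodule k Z} {p q : ZMod 2}

theorem HasParity.comp {ψ : Y →ₗ[k] Z} {φ : X →ₗ[k] Y} (hψ : HasParity 𝒴 𝒵 q ψ)
    (hφ : HasParity 𝒳 𝒴 p φ) : HasParity 𝒳 𝒵 (p + q) (ψ ∘ₗ φ) := fun i x hx =>
  add_assoc i p q ▸ hψ _ _ (hφ i x hx)

theorem HasParity.sub {φ ψ : X →ₗ[k] Y} (hφ : HasParity 𝒳 𝒴 p φ) (hψ : HasParity 𝒳 𝒴 p ψ) :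
    HasParity 𝒳 𝒴 p (φ - ψ) := fun i x hx => sub_mem (hφ i x hx) (hψ i x hx)

theorem HasParity.smul {φ : X →ₗ[k] Y} (c : k) (hφ : HasParity 𝒳 𝒴 p φ) :
    HasParity 𝒳 𝒴 p (c • φ) := fun i x hx => Submodule.smul_mem _ c (hφ i x hx)

/-- `f` is the parity operator `x ↦ (-1)^x x` of `X`, which is spanned by its homogeneous
elements. The sum `𝒳 0 + 𝒳 1` need not be direct. -/
structure IsSignOperator (𝒳 : ZMod 2 → Submodule k X) (f : Module.End k X) : Prop where
  apply_of_mem : ∀ {i : ZMod 2} {x : X}, x ∈ 𝒳 i → f x = sgn k i 1 • x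
  sup_eq_top : 𝒳 0 ⊔ 𝒳 1 = ⊤

namespace IsSignOperator

variable {f : Module.End k X} {g : Module.End k Y}

theorem exists_add_eq (hf : IsSignOperator 𝒳 f) (x : X) : ∃ a ∈ 𝒳 0, ∃ b ∈ 𝒳 1, a + b = x :=
  Submodule.mem_sup.1 (hf.sup_eq_top ▸ Submodule.mem_top)

theorem linearMap_ext (hf : IsSignOperator 𝒳 f) {φ ψ : X →ₗ[k] Y}
    (h : ∀ i, ∀ x ∈ 𝒳 i, φ x = ψ x) : φ = ψ :=
  LinearMap.ext fun x => by
    obtain ⟨a, ha, b, hb, rfl⟩ := hf.exists_add_eq x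
    rw [map_add, map_add, h 0 a ha, h 1 b hb]

theorem pow_apply_of_mem (hf : IsSignOperator 𝒳 f) {i : ZMod 2} {x : X} (hx : x ∈ 𝒳 i) :
    (f ^ p.val) x = sgn k i p • x := by
  rcases zmod_two_cases p with rfl | rfl
  · simp [sgn_zero_right]
  · simp [ZMod.val_one, hf.apply_of_mem hx]

theorem pow_add (hf : IsSignOperator 𝒳 f) (p q : ZMod 2) :
    f ^ (p + q).val = f ^ p.val * f ^ q.val :=
  hf.linearMap_ext fun i x hx => by
    rw [Module.End.mul_apply, hf.pow_apply_of_mem hx, hf.pow_apply_of_mem hx, map_smul,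
      hf.pow_apply_of_mem hx, smul_smul, sgn_add_right, mul_comm]

theorem pow_apply_map (hf : IsSignOperator 𝒳 f) (hg : IsSignOperator 𝒴 g) {φ : X →ₗ[k] Y}
    (hφ : HasParity 𝒳 𝒴 p φ) (q : ZMod 2) (x : X) :
    (g ^ q.val) (φ x) = sgn k p q • φ ((f ^ q.val) x) := by
  suffices h : (g ^ q.val) ∘ₗ φ = sgn k p q • φ ∘ₗ f ^ q.val from LinearMap.congr_fun h x
  refine hf.linearMap_ext fun i x hx => ?_
  rw [LinearMap.comp_apply, LinearMap.smul_apply, LinearMap.comp_apply, hf.pow_apply_of_mem hx,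
    hg.pow_apply_of_mem (hφ i x hx), map_smul, smul_smul, sgn_add_left, mul_comm]

theorem disjoint [IsAddTorsionFree X] (hf : IsSignOperator 𝒳 f) : Disjoint (𝒳 0) (𝒳 1) := by
  refine Submodule.disjoint_def.2 fun x h₀ h₁ => self_eq_neg.1 ?_
  calc x = f x := by rw [hf.apply_of_mem h₀, sgn_zero_left, one_smul]
    _ = -x := by rw [hf.apply_of_mem h₁, sgn_one_one, neg_one_smul]

theorem hasParity_symm [IsAddTorsionFree Y] (hf : IsSignOperator 𝒳 f) (hg : IsSignOperator 𝒴 g)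
    {e : X ≃ₗ[k] Y} (he : HasParity 𝒳 𝒴 0 e.toLinearMap) :
    HasParity 𝒴 𝒳 0 e.symm.toLinearMap := by
  intro i y hy
  obtain ⟨a, ha, b, hb, hab⟩ := hf.exists_add_eq (e.symm y)
  have hy' : e a + e b = y := by rw [← map_add, hab, e.apply_symm_apply]
  have hea : e a ∈ 𝒴 0 := he 0 a ha
  have heb : e b ∈ 𝒴 1 := he 1 b hb
  rw [LinearEquiv.coe_coe, ← hab, add_zero]
  rcases zmod_two_cases i with rfl | rfl
  · have h : e b ∈ 𝒴 0 := by simpa [← hy', Submodule.add_mem_iff_right _ hea] using hy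
    rwa [(map_eq_zero_iff e e.injective).1 (Submodule.disjoint_def.1 hg.disjoint _ h heb), add_zero]
  · have h : e a ∈ 𝒴 1 := by simpa [← hy', Submodule.add_mem_iff_left _ heb] using hy
    rwa [(map_eq_zero_iff e e.injective).1 (Submodule.disjoint_def.1 hg.disjoint _ hea h), zero_add]

end IsSignOperator

/-- The operator `F ⊗ 1 + 1 ⊗ F` on `X ⊗ X` for `F` of parity `p`; the parity operator `S` of `X`
supplies the Koszul sign in `(1 ⊗ F)(a ⊗ b) = (-1)^(a p) a ⊗ F b`. -/
def leibniz (S : Module.End k X) (p : ZMod 2) (F : Module.End k X) : Module.End k (X ⊗[k] X) :=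
  TensorProduct.map F LinearMap.id + TensorProduct.map (S ^ p.val) F

/-- The graded commutator of operators of parities `p` and `q`. -/
def commutator (p q : ZMod 2) (F G : Module.End k X) : Module.End k X :=
  F ∘ₗ G - sgn k p q • (G ∘ₗ F)

variable {S F G : Module.End k X}

theorem leibniz_tmul (a b : X) :
    leibniz S p F (a ⊗ₜ b) = F a ⊗ₜ b + (S ^ p.val) a ⊗ₜ F b := by
  simp [leibniz]

theorem leibniz_sub : leibniz S p (F - G) = leibniz S p F - leibniz S p G :=
  TensorProduct.ext' fun a b => by
    simp only [leibniz_tmul, LinearMap.sub_apply, TensorProduct.sub_tmul, TensorProduct.tmul_sub]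
    abel

theorem leibniz_commutator (hS : IsSignOperator 𝒳 S) (hF : HasParity 𝒳 𝒳 p F)
    (hG : HasParity 𝒳 𝒳 q G) :
    leibniz S (p + q) (commutator p q F G) = commutator p q (leibniz S p F) (leibniz S q G) :=
  TensorProduct.ext' fun a b => by
    have hqp : (S ^ q.val) ((S ^ p.val) a) = (S ^ p.val) ((S ^ q.val) a) := by
      rw [← Module.End.mul_apply, ← Module.End.mul_apply, ← hS.pow_add, ← hS.pow_add, add_comm]
    simp only [commutator, leibniz_tmul, LinearMap.sub_apply, LinearMap.smul_apply,
      LinearMap.comp_apply, map_add, hS.pow_apply_map hS hF, hS.pow_apply_map hS hG, hS.pow_add,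
      Module.End.mul_apply, hqp, sgn_comm k q p, TensorProduct.sub_tmul, TensorProduct.tmul_sub,
      TensorProduct.smul_tmul, TensorProduct.tmul_smul, smul_add, smul_smul, sgn_mul_self, one_smul]
    abel

theorem HasParity.commutator (hF : HasParity 𝒳 𝒳 p F) (hG : HasParity 𝒳 𝒳 q G) :
    HasParity 𝒳 𝒳 (p + q) (commutator p q F G) :=
  (add_comm q p ▸ hF.comp hG).sub ((hG.comp hF).smul _)

end Parity

/-! ### The graded symmetric algebra -/

section Symmetric

variable {k : Type*} [CommRing k] {W : Type*} [AddCommGroup W] [Module k W]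
  {𝒲 : ZMod 2 → Submodule k W} {i j p : ZMod 2} {w : W}

theorem aug_ι (w : W) : aug 𝒲 (ι 𝒲 w) = 0 := lift_ι 𝒲 _ _ w

theorem aug_incl (x : Sym 𝒲) : aug 𝒲 (incl 𝒲 x) = 0 := x.2

theorem incl_injective : Function.Injective (incl 𝒲) := Subtype.val_injective

theorem incl_toSym_of_aug_eq_zero {x : SymAlg 𝒲} (h : aug 𝒲 x = 0) : incl 𝒲 (toSym 𝒲 x) = x := by
  rw [incl_toSym, h, map_zero, sub_zero]

theorem toSym_one : toSym 𝒲 1 = 0 :=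
  incl_injective (by rw [incl_toSym, map_one, map_one, sub_self, map_zero])

/-- The elements of parity `i` of the unital symmetric algebra, as in `symGrading`. -/
def algGrading (𝒲 : ZMod 2 → Submodule k W) (i : ZMod 2) : Submodule k (SymAlg 𝒲) :=
  Submodule.span k {x : SymAlg 𝒲 | ∃ (n : ℕ) (p : Fin n → ZMod 2) (v : Fin n → W),
    (∀ j, v j ∈ 𝒲 (p j)) ∧ ∑ j, p j = i ∧ x = (List.ofFn fun j => ι 𝒲 (v j)).prod}

theorem mem_symGrading {x : Sym 𝒲} : x ∈ symGrading 𝒲 i ↔ incl 𝒲 x ∈ algGrading 𝒲 i := Iff.rfl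

theorem one_mem_algGrading : 1 ∈ algGrading 𝒲 0 :=
  Submodule.subset_span ⟨0, Fin.elim0, Fin.elim0, fun j => j.elim0, by simp, by simp⟩

theorem ι_mul_mem_algGrading (hw : w ∈ 𝒲 i) {x : SymAlg 𝒲} (hx : x ∈ algGrading 𝒲 j) :
    ι 𝒲 w * x ∈ algGrading 𝒲 (i + j) := by
  suffices h : algGrading 𝒲 j ≤ (algGrading 𝒲 (i + j)).comap (LinearMap.mulLeft k (ι 𝒲 w)) from h hx
  refine Submodule.span_le.2 ?_
  rintro _ ⟨n, p, v, hv, rfl, rfl⟩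
  refine Submodule.subset_span ⟨n + 1, Fin.cons i p, Fin.cons w v, ?_, ?_, ?_⟩
  · exact Fin.cases (by simpa using hw) (by simpa using hv)
  · simp [Fin.sum_univ_succ]
  · simp [List.ofFn_succ]

theorem ι_mem_algGrading (hw : w ∈ 𝒲 i) : ι 𝒲 w ∈ algGrading 𝒲 i := by
  simpa using ι_mul_mem_algGrading hw one_mem_algGrading

theorem HasParity.comp_mulLeft_ι {ψ : SymAlg 𝒲 →ₗ[k] W}
    (hψ : HasParity (algGrading 𝒲) 𝒲 p ψ) (hw : w ∈ 𝒲 i) :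
    HasParity (algGrading 𝒲) 𝒲 (p + i) (ψ ∘ₗ LinearMap.mulLeft k (ι 𝒲 w)) := fun j x hx => by
  have h := hψ _ _ (ι_mul_mem_algGrading hw hx)
  rwa [show i + j + p = j + (p + i) by ring] at h

theorem algGrading_le {N : ZMod 2 → Submodule k (SymAlg 𝒲)} (one : 1 ∈ N 0)
    (ι_mul : ∀ i j, ∀ w ∈ 𝒲 i, ∀ x ∈ N j, ι 𝒲 w * x ∈ N (i + j)) (i : ZMod 2) :
    algGrading 𝒲 i ≤ N i := by
  refine Submodule.span_le.2 ?_
  rintro _ ⟨n, p, v, hv, rfl, rfl⟩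
  induction n with
  | zero => simpa using one
  | succ n ih =>
    rw [List.ofFn_succ, List.prod_cons, Fin.sum_univ_succ]
    exact ι_mul _ _ _ (hv 0) _ (ih _ _ fun j => hv j.succ)

theorem aug_eq_zero_of_mem_algGrading_one {x : SymAlg 𝒲} (hx : x ∈ algGrading 𝒲 1) :
    aug 𝒲 x = 0 := by
  have h := algGrading_le (𝒲 := 𝒲)
    (N := fun i => if i = 0 then ⊤ else LinearMap.ker (aug 𝒲).toLinearMap) (by simp)
    (fun i j w _ x _ => by split <;> simp [aug_ι]) 1 hx
  simpa using h

theorem hasParity_toSym : HasParity (algGrading 𝒲) (symGrading 𝒲) 0 (toSym 𝒲) := by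
  intro i x hx
  rw [add_zero, mem_symGrading]
  rcases zmod_two_cases i with rfl | rfl
  · rw [incl_toSym, Algebra.algebraMap_eq_smul_one]
    exact sub_mem hx (Submodule.smul_mem _ _ one_mem_algGrading)
  · rwa [incl_toSym_of_aug_eq_zero (aug_eq_zero_of_mem_algGrading_one hx)]

theorem degreeOneRep_ι (w : W) (x : k × W) : degreeOneRep 𝒲 (ι 𝒲 w) x = (0, x.1 • w) := by
  rw [degreeOneRep, lift_ι]; rfl

/-- The projection of the unital symmetric algebra to its component of degree one. -/
def degreeOne (𝒲 : ZMod 2 → Submodule k W) : SymAlg 𝒲 →ₗ[k] W := toW 𝒲 ∘ₗ toSym 𝒲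

theorem degreeOne_incl (x : Sym 𝒲) : degreeOne 𝒲 (incl 𝒲 x) = toW 𝒲 x := by
  rw [degreeOne, LinearMap.comp_apply, toSym_incl]

theorem degreeOne_one : degreeOne 𝒲 1 = 0 := by
  rw [degreeOne, LinearMap.comp_apply, toSym_one, map_zero]

variable [DirectSum.Decomposition 𝒲]

theorem SymAlg.induction {C : SymAlg 𝒲 → Prop} (one : C 1)
    (add : ∀ x y, C x → C y → C (x + y)) (smul : ∀ (c : k) x, C x → C (c • x))
    (ι_mul : ∀ i, ∀ w ∈ 𝒲 i, ∀ x, C x → C (ι 𝒲 w * x)) (x : SymAlg 𝒲) : C x := by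
  obtain ⟨a, rfl⟩ : ∃ a, mkSym 𝒲 a = x := RingQuot.mkAlgHom_surjective k (SymRel 𝒲) x
  suffices h : ∀ y, C y → C (mkSym 𝒲 a * y) by simpa using h 1 one
  induction a using TensorAlgebra.induction with
  | algebraMap r =>
    intro y hy
    rw [AlgHom.commutes, ← Algebra.smul_def]
    exact smul r y hy
  | ι w =>
    intro y hy
    change C (ι 𝒲 w * y)
    rw [← proj_add_proj 𝒲 w, map_add, add_mul]
    exact add _ _ (ι_mul 0 _ (proj_mem 𝒲 0 w) y hy) (ι_mul 1 _ (proj_mem 𝒲 1 w) y hy)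
  | mul a b ha hb =>
    intro y hy
    rw [map_mul, mul_assoc]
    exact ha _ (hb _ hy)
  | add a b ha hb =>
    intro y hy
    rw [map_add, add_mul]
    exact add _ _ (ha y hy) (hb y hy)

/-- The parity operator `w ↦ (-1)^w w` of `W`. -/
def sign (𝒲 : ZMod 2 → Submodule k W) [DirectSum.Decomposition 𝒲] : Module.End k W :=
  proj 𝒲 0 - proj 𝒲 1

theorem isSignOperator_sign : IsSignOperator 𝒲 (sign 𝒲) where
  apply_of_mem hx := sign_W 𝒲 hx
  sup_eq_top := eq_top_iff.2 fun x _ => by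
    rw [← proj_add_proj 𝒲 x]
    exact Submodule.add_mem_sup (proj_mem 𝒲 0 x) (proj_mem 𝒲 1 x)

theorem algGrading_sup_eq_top : algGrading 𝒲 0 ⊔ algGrading 𝒲 1 = ⊤ := by
  refine eq_top_iff.2 fun x _ => ?_
  induction x using SymAlg.induction with
  | one => exact Submodule.mem_sup_left one_mem_algGrading
  | add x y hx hy => exact add_mem (hx trivial) (hy trivial)
  | smul c x hx => exact Submodule.smul_mem _ c (hx trivial)
  | ι_mul i w hw x hx =>
    obtain ⟨a, ha, b, hb, rfl⟩ := Submodule.mem_sup.1 (hx trivial)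
    have ha' := ι_mul_mem_algGrading hw ha
    have hb' := ι_mul_mem_algGrading hw hb
    rw [mul_add]
    rcases zmod_two_cases i with rfl | rfl
    · exact Submodule.add_mem_sup ha' hb'
    · exact add_comm (ι 𝒲 w * b) _ ▸ Submodule.add_mem_sup hb' ha'

theorem parityAut_of_mem_algGrading {x : SymAlg 𝒲} (hx : x ∈ algGrading 𝒲 i) :
    parityAut 𝒲 x = sgn k i 1 • x := by
  refine algGrading_le (N := fun i => LinearMap.eqLocus (parityAut 𝒲).toLinearMap
    (sgn k i 1 • LinearMap.id)) (by simp [sgn_zero_left]) (fun i j w hw x hx => ?_) i hx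
  simp only [LinearMap.mem_eqLocus, AlgHom.toLinearMap_apply, LinearMap.smul_apply,
    LinearMap.id_apply] at hx ⊢
  rw [map_mul, hx, parityAut_ι 𝒲 hw, smul_mul_smul_comm, sgn_add_left]

theorem isSignOperator_parityAut :
    IsSignOperator (algGrading 𝒲) (parityAut 𝒲).toLinearMap where
  apply_of_mem := parityAut_of_mem_algGrading
  sup_eq_top := algGrading_sup_eq_top

theorem isSignOperator_symSign : IsSignOperator (symGrading 𝒲) (symSign 𝒲) where
  apply_of_mem {i x} hx := by
    simp only [symSign, LinearMap.comp_apply, AlgHom.toLinearMap_apply,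
      parityAut_of_mem_algGrading (mem_symGrading.1 hx), map_smul, toSym_incl]
  sup_eq_top := eq_top_iff.2 fun x _ => by
    obtain ⟨a, ha, b, hb, hab⟩ := isSignOperator_parityAut.exists_add_eq (incl 𝒲 x)
    rw [← toSym_incl 𝒲 x, ← hab, map_add]
    exact Submodule.add_mem_sup (hasParity_toSym 0 a ha) (hasParity_toSym 1 b hb)

theorem symSign_pow_toSym (p : ZMod 2) (x : SymAlg 𝒲) :
    (symSign 𝒲 ^ p.val) (toSym 𝒲 x) = toSym 𝒲 (((parityAut 𝒲).toLinearMap ^ p.val) x) := by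
  rw [isSignOperator_parityAut.pow_apply_map isSignOperator_symSign hasParity_toSym,
    sgn_zero_left, one_smul]

theorem aug_parityAut_pow (p : ZMod 2) (x : SymAlg 𝒲) :
    aug 𝒲 (((parityAut 𝒲).toLinearMap ^ p.val) x) = aug 𝒲 x := by
  refine LinearMap.congr_fun (f := (aug 𝒲).toLinearMap ∘ₗ _) (g := (aug 𝒲).toLinearMap)
    (isSignOperator_parityAut.linearMap_ext fun i x hx => ?_) x
  rw [LinearMap.comp_apply, isSignOperator_parityAut.pow_apply_of_mem hx, map_smul]
  rcases zmod_two_cases i with rfl | rfl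
  · rw [sgn_zero_left, one_smul]
  · rw [AlgHom.toLinearMap_apply, aug_eq_zero_of_mem_algGrading_one hx, smul_zero]

theorem parityAut_pow_ι_mul (p : ZMod 2) (hw : w ∈ 𝒲 i) (x : SymAlg 𝒲) :
    ((parityAut 𝒲).toLinearMap ^ p.val) (ι 𝒲 w * x) =
      sgn k p i • (ι 𝒲 w * ((parityAut 𝒲).toLinearMap ^ p.val) x) := by
  have h : HasParity (algGrading 𝒲) (algGrading 𝒲) i (LinearMap.mulLeft k (ι 𝒲 w)) :=
    fun j x hx => add_comm i j ▸ ι_mul_mem_algGrading hw hx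
  rw [sgn_comm]
  exact isSignOperator_parityAut.pow_apply_map isSignOperator_parityAut h p x

theorem ι_mul_ι (hw : w ∈ 𝒲 i) (v : W) :
    ι 𝒲 v * ι 𝒲 w = ι 𝒲 w * ι 𝒲 ((sign 𝒲 ^ i.val) v) := by
  obtain ⟨a, ha, b, hb, rfl⟩ := isSignOperator_sign.exists_add_eq (𝒳 := 𝒲) v
  simp only [map_add, add_mul, mul_add, ι_comm ha hw, ι_comm hb hw,
    isSignOperator_sign.pow_apply_of_mem ha, isSignOperator_sign.pow_apply_of_mem hb, map_smul,
    mul_smul_comm]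

/-! ### The degree-one component and the counit -/

theorem fst_degreeOneRep (x : SymAlg 𝒲) : (degreeOneRep 𝒲 x (1, 0)).1 = aug 𝒲 x := by
  induction x using SymAlg.induction with
  | one => simp
  | add x y hx hy => simp [hx, hy]
  | smul c x hx => simp [hx]
  | ι_mul _ w _ x _ => simp [degreeOneRep_ι, aug_ι]

theorem degreeOne_ι_mul (w : W) (x : SymAlg 𝒲) : degreeOne 𝒲 (ι 𝒲 w * x) = aug 𝒲 x • w := by
  have h : aug 𝒲 (ι 𝒲 w * x) = 0 := by rw [map_mul, aug_ι, zero_mul]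
  rw [degreeOne, LinearMap.comp_apply, toW_apply, incl_toSym_of_aug_eq_zero h, map_mul,
    Module.End.mul_apply, degreeOneRep_ι, fst_degreeOneRep]

theorem hasParity_degreeOne : HasParity (algGrading 𝒲) 𝒲 0 (degreeOne 𝒲) := by
  intro i x hx
  rw [add_zero]
  refine (algGrading_le (N := fun i => algGrading 𝒲 i ⊓ (𝒲 i).comap (degreeOne 𝒲))
    ⟨one_mem_algGrading, by simp [degreeOne_one]⟩ (fun i j w hw x hx => ?_) i hx).2
  refine ⟨ι_mul_mem_algGrading hw hx.1, ?_⟩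
  rw [SetLike.mem_coe, Submodule.mem_comap, degreeOne_ι_mul]
  rcases zmod_two_cases j with rfl | rfl
  · rw [add_zero]
    exact Submodule.smul_mem _ _ hw
  · rw [aug_eq_zero_of_mem_algGrading_one hx.1, zero_smul]
    exact zero_mem _

theorem toW_mem_cochains : toW 𝒲 ∈ cochains 𝒲 0 := fun i x hx =>
  degreeOne_incl x ▸ hasParity_degreeOne i _ hx

theorem lid_rTensor_aug_fullDiagonal (x : SymAlg 𝒲) :
    TensorProduct.lid k _ ((aug 𝒲).toLinearMap.rTensor _ (fullDiagonal 𝒲 x)) = x := by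
  induction x using SymAlg.induction with
  | one => simp [fullDiagonal_one]
  | add x y hx hy => simp only [map_add, hx, hy]
  | smul c x hx => simp only [map_smul, hx]
  | ι_mul i w hw x hx =>
    have h : (TensorProduct.lid k _).toLinearMap ∘ₗ (aug 𝒲).toLinearMap.rTensor _ ∘ₗ mulPrim 𝒲 w =
        LinearMap.mulLeft k (ι 𝒲 w) ∘ₗ (TensorProduct.lid k _).toLinearMap ∘ₗ
          (aug 𝒲).toLinearMap.rTensor _ :=
      TensorProduct.ext' fun a b => by
        simp [mulPrim_tmul_of_mem 𝒲 hw, aug_ι, aug_parityAut_pow]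
    rw [fullDiagonal_ι_mul]
    exact (LinearMap.congr_fun h _).trans (congrArg (ι 𝒲 w * ·) hx)

theorem rid_lTensor_aug_fullDiagonal (x : SymAlg 𝒲) :
    TensorProduct.rid k _ ((aug 𝒲).toLinearMap.lTensor _ (fullDiagonal 𝒲 x)) = x := by
  induction x using SymAlg.induction with
  | one => simp [fullDiagonal_one]
  | add x y hx hy => simp only [map_add, hx, hy]
  | smul c x hx => simp only [map_smul, hx]
  | ι_mul i w hw x hx =>
    have h : (TensorProduct.rid k _).toLinearMap ∘ₗ (aug 𝒲).toLinearMap.lTensor _ ∘ₗ mulPrim 𝒲 w =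
        LinearMap.mulLeft k (ι 𝒲 w) ∘ₗ (TensorProduct.rid k _).toLinearMap ∘ₗ
          (aug 𝒲).toLinearMap.lTensor _ :=
      TensorProduct.ext' fun a b => by
        simp [mulPrim_tmul_of_mem 𝒲 hw, aug_ι]
    rw [fullDiagonal_ι_mul]
    exact (LinearMap.congr_fun h _).trans (congrArg (ι 𝒲 w * ·) hx)

end Symmetric

/-! ### The extension of a cochain -/

section Extension

variable {k : Type*} [CommRing k] {W : Type*} [AddCommGroup W] [Module k W]
  {𝒲 : ZMod 2 → Submodule k W} [DirectSum.Decomposition 𝒲] {i p : ZMod 2} {w : W}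
  {ψ : SymAlg 𝒲 →ₗ[k] W}

/-- The extension `x ↦ Σ ψ(x₁) ⊙ x₂` of a linear map `ψ` to the unital symmetric algebra, where
`Σ x₁ ⊗ x₂` is the full diagonal of `x`. -/
def fullExtend (ψ : SymAlg 𝒲 →ₗ[k] W) : SymAlg 𝒲 →ₗ[k] SymAlg 𝒲 :=
  LinearMap.mul' k (SymAlg 𝒲) ∘ₗ TensorProduct.map (ι 𝒲 ∘ₗ ψ) LinearMap.id ∘ₗ fullDiagonal 𝒲

theorem extend_apply (φ : Cochain 𝒲) (x : Sym 𝒲) :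
    extend 𝒲 φ x = toSym 𝒲 (fullExtend (φ ∘ₗ toSym 𝒲) (incl 𝒲 x)) := rfl

theorem fullExtend_one (ψ : SymAlg 𝒲 →ₗ[k] W) : fullExtend ψ 1 = ι 𝒲 (ψ 1) := by
  simp [fullExtend, fullDiagonal_one]

theorem aug_fullExtend (ψ : SymAlg 𝒲 →ₗ[k] W) (x : SymAlg 𝒲) : aug 𝒲 (fullExtend ψ x) = 0 := by
  have h : (aug 𝒲).toLinearMap ∘ₗ LinearMap.mul' k _ ∘ₗ
      TensorProduct.map (ι 𝒲 ∘ₗ ψ) LinearMap.id = 0 :=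
    TensorProduct.ext' fun a b => by simp [aug_ι]
  exact LinearMap.congr_fun h _

theorem fullExtend_smulRight_aug (w : W) (x : SymAlg 𝒲) :
    fullExtend ((aug 𝒲).toLinearMap.smulRight w) x = ι 𝒲 w * x := by
  have h : LinearMap.mul' k (SymAlg 𝒲) ∘ₗ
      TensorProduct.map (ι 𝒲 ∘ₗ (aug 𝒲).toLinearMap.smulRight w) LinearMap.id =
      LinearMap.mulLeft k (ι 𝒲 w) ∘ₗ (TensorProduct.lid k _).toLinearMap ∘ₗ
        (aug 𝒲).toLinearMap.rTensor _ :=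
    TensorProduct.ext' fun a b => by simp
  exact (LinearMap.congr_fun h _).trans
    (congrArg (ι 𝒲 w * ·) (lid_rTensor_aug_fullDiagonal x))

theorem incl_extend (φ : Cochain 𝒲) (x : Sym 𝒲) :
    incl 𝒲 (extend 𝒲 φ x) = ι 𝒲 (φ x) +
      LinearMap.mul' k (SymAlg 𝒲) (TensorProduct.map (ι 𝒲 ∘ₗ φ) (incl 𝒲) (diagonal 𝒲 x)) := by
  have h : LinearMap.mul' k (SymAlg 𝒲) ∘ₗ TensorProduct.map (ι 𝒲 ∘ₗ φ ∘ₗ toSym 𝒲) LinearMap.id =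
      ι 𝒲 ∘ₗ φ ∘ₗ toSym 𝒲 ∘ₗ (TensorProduct.rid k _).toLinearMap ∘ₗ
          (aug 𝒲).toLinearMap.lTensor _ +
        LinearMap.mul' k (SymAlg 𝒲) ∘ₗ TensorProduct.map (ι 𝒲 ∘ₗ φ) (incl 𝒲) ∘ₗ
          TensorProduct.map (toSym 𝒲) (toSym 𝒲) :=
    TensorProduct.ext' fun a b => by
      simp [incl_toSym, mul_sub, Algebra.algebraMap_eq_smul_one]
  rw [extend_apply, incl_toSym_of_aug_eq_zero (aug_fullExtend _ _)]
  have hx := LinearMap.congr_fun h (fullDiagonal 𝒲 (incl 𝒲 x))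
  simp only [LinearMap.add_apply, LinearMap.comp_apply, LinearEquiv.coe_coe,
    rid_lTensor_aug_fullDiagonal, toSym_incl] at hx
  exact hx

theorem toW_extend (φ : Cochain 𝒲) : toW 𝒲 ∘ₗ extend 𝒲 φ = φ := by
  have h : degreeOne 𝒲 ∘ₗ LinearMap.mul' k (SymAlg 𝒲) ∘ₗ
      TensorProduct.map (ι 𝒲 ∘ₗ φ) (incl 𝒲) = 0 :=
    TensorProduct.ext' fun a b => by simp [degreeOne_ι_mul, aug_incl]
  refine LinearMap.ext fun x => ?_
  rw [LinearMap.comp_apply, ← degreeOne_incl, incl_extend, map_add, ← mul_one (ι 𝒲 (φ x)),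
    degreeOne_ι_mul, map_one, one_smul]
  exact add_eq_left.2 (LinearMap.congr_fun h (diagonal 𝒲 x))

theorem extend_toSym (φ : Cochain 𝒲) (x : SymAlg 𝒲) :
    extend 𝒲 φ (toSym 𝒲 x) = toSym 𝒲 (fullExtend (φ ∘ₗ toSym 𝒲) x) := by
  rw [extend_apply, incl_toSym, Algebra.algebraMap_eq_smul_one, map_sub, map_smul, fullExtend_one,
    LinearMap.comp_apply, toSym_one, map_zero, map_zero, smul_zero, sub_zero]

theorem fullExtend_ι_mul (hψ : HasParity (algGrading 𝒲) 𝒲 p ψ) (hw : w ∈ 𝒲 i) (x : SymAlg 𝒲) :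
    fullExtend ψ (ι 𝒲 w * x) = fullExtend (ψ ∘ₗ LinearMap.mulLeft k (ι 𝒲 w)) x +
      sgn k p i • (ι 𝒲 w * fullExtend ψ x) := by
  have h : LinearMap.mul' k (SymAlg 𝒲) ∘ₗ TensorProduct.map (ι 𝒲 ∘ₗ ψ) LinearMap.id ∘ₗ
      mulPrim 𝒲 w = LinearMap.mul' k (SymAlg 𝒲) ∘ₗ
        TensorProduct.map (ι 𝒲 ∘ₗ ψ ∘ₗ LinearMap.mulLeft k (ι 𝒲 w)) LinearMap.id +
      sgn k p i • LinearMap.mulLeft k (ι 𝒲 w) ∘ₗ LinearMap.mul' k (SymAlg 𝒲) ∘ₗ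
        TensorProduct.map (ι 𝒲 ∘ₗ ψ) LinearMap.id :=
    TensorProduct.ext' fun a b => by
      have hcomm : ι 𝒲 (ψ (((parityAut 𝒲).toLinearMap ^ i.val) a)) * ι 𝒲 w =
          sgn k p i • (ι 𝒲 w * ι 𝒲 (ψ a)) := by
        rw [ι_mul_ι hw, isSignOperator_parityAut.pow_apply_map isSignOperator_sign hψ,
          ← Module.End.mul_apply, ← isSignOperator_parityAut.pow_add, CharTwo.add_self_eq_zero,
          map_smul, mul_smul_comm]
        simp
      simp only [LinearMap.comp_apply, LinearMap.add_apply, LinearMap.smul_apply,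
        mulPrim_tmul_of_mem 𝒲 hw, map_add, TensorProduct.map_tmul, LinearMap.mul'_apply,
        LinearMap.id_apply, LinearMap.mulLeft_apply, ← mul_assoc, hcomm, smul_mul_assoc]
  rw [fullExtend, LinearMap.comp_apply, LinearMap.comp_apply, fullDiagonal_ι_mul]
  exact LinearMap.congr_fun h (fullDiagonal 𝒲 x)

theorem HasParity.fullExtend (hψ : HasParity (algGrading 𝒲) 𝒲 p ψ) :
    HasParity (algGrading 𝒲) (algGrading 𝒲) p (fullExtend ψ) := by
  let N (i : ZMod 2) : Submodule k (SymAlg 𝒲) :=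
    ⨅ (p) (ψ) (_ : HasParity (algGrading 𝒲) 𝒲 p ψ),
      (algGrading 𝒲 (i + p)).comap (LInfinity.fullExtend ψ)
  suffices h : ∀ i, algGrading 𝒲 i ≤ N i by
    intro i x hx
    have hN := h i hx
    simp only [N, Submodule.mem_iInf, Submodule.mem_comap] at hN
    exact hN p ψ hψ
  refine algGrading_le ?_ fun i j w hw x hx => ?_
  all_goals simp only [N, Submodule.mem_iInf, Submodule.mem_comap] at *
  · intro p ψ hψ
    rw [fullExtend_one]
    exact ι_mem_algGrading (hψ 0 1 one_mem_algGrading)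
  · intro p ψ hψ
    rw [fullExtend_ι_mul hψ hw, add_assoc i]
    refine add_mem ?_ (Submodule.smul_mem _ _ (ι_mul_mem_algGrading hw (hx p ψ hψ)))
    have h := hx _ _ (hψ.comp_mulLeft_ι hw)
    rwa [show j + (p + i) = i + (j + p) by ring] at h

theorem leibniz_fullExtend_mulPrim (hψ : HasParity (algGrading 𝒲) 𝒲 p ψ) (hw : w ∈ 𝒲 i)
    (z : SymAlg 𝒲 ⊗[k] SymAlg 𝒲) :
    leibniz (parityAut 𝒲).toLinearMap p (fullExtend ψ) (mulPrim 𝒲 w z) =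
      leibniz (parityAut 𝒲).toLinearMap (p + i)
          (fullExtend (ψ ∘ₗ LinearMap.mulLeft k (ι 𝒲 w))) z +
        sgn k p i • mulPrim 𝒲 w (leibniz (parityAut 𝒲).toLinearMap p (fullExtend ψ) z) := by
  have hP : IsSignOperator (algGrading 𝒲) (parityAut 𝒲).toLinearMap := isSignOperator_parityAut
  induction z using TensorProduct.induction_on with
  | zero => simp
  | add y z hy hz =>
    simp only [map_add, smul_add, hy, hz]
    abel
  | tmul a b =>
    have hcomm : fullExtend ψ (((parityAut 𝒲).toLinearMap ^ i.val) a) =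
        sgn k p i • ((parityAut 𝒲).toLinearMap ^ i.val) (fullExtend ψ a) := by
      rw [hP.pow_apply_map hP hψ.fullExtend, smul_smul, sgn_mul_self, one_smul]
    have hpi : ((parityAut 𝒲).toLinearMap ^ p.val) (((parityAut 𝒲).toLinearMap ^ i.val) a) =
        ((parityAut 𝒲).toLinearMap ^ (p + i).val) a := by rw [hP.pow_add, Module.End.mul_apply]
    have hip : ((parityAut 𝒲).toLinearMap ^ i.val) (((parityAut 𝒲).toLinearMap ^ p.val) a) =
        ((parityAut 𝒲).toLinearMap ^ (p + i).val) a := by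
      rw [add_comm p, hP.pow_add, Module.End.mul_apply]
    simp only [map_add, leibniz_tmul, mulPrim_tmul_of_mem 𝒲 hw, fullExtend_ι_mul hψ hw,
      parityAut_pow_ι_mul p hw, hcomm, hpi, hip, TensorProduct.add_tmul, TensorProduct.tmul_add,
      TensorProduct.smul_tmul', TensorProduct.tmul_smul, smul_add]
    abel

theorem fullDiagonal_fullExtend (hψ : HasParity (algGrading 𝒲) 𝒲 p ψ) (x : SymAlg 𝒲) :
    fullDiagonal 𝒲 (fullExtend ψ x) =
      leibniz (parityAut 𝒲).toLinearMap p (fullExtend ψ) (fullDiagonal 𝒲 x) := by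
  induction x using SymAlg.induction generalizing p ψ with
  | one =>
    have hp : ((parityAut 𝒲).toLinearMap ^ p.val) 1 = 1 := by
      rw [isSignOperator_parityAut.pow_apply_of_mem one_mem_algGrading, sgn_zero_left, one_smul]
    rw [fullExtend_one, ← mul_one (ι 𝒲 (ψ 1)), fullDiagonal_ι_mul, fullDiagonal_one, leibniz_tmul,
      hp, fullExtend_one, mulPrim_tmul, map_one (parityAut 𝒲), mul_one, mul_one, mul_one, add_assoc,
      ← TensorProduct.tmul_add, ← map_add, proj_add_proj]
  | add x y hx hy => simp only [map_add, hx hψ, hy hψ]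
  | smul c x hx => simp only [map_smul, hx hψ]
  | ι_mul i w hw x hx =>
    rw [fullExtend_ι_mul hψ hw, map_add, map_smul, fullDiagonal_ι_mul, fullDiagonal_ι_mul, hx hψ,
      hx (hψ.comp_mulLeft_ι hw), leibniz_fullExtend_mulPrim hψ hw]

theorem isCoderivation_extend {φ : Cochain 𝒲} (hφ : φ ∈ cochains 𝒲 p) :
    IsCoderivation 𝒲 p (extend 𝒲 φ) where
  parity := by
    have h := hasParity_toSym.comp ((HasParity.comp hφ hasParity_toSym).fullExtend)
    rw [zero_add, add_zero] at h
    exact fun i x hx => h i (incl 𝒲 x) hx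
  diagonal_comp := by
    have hψ : HasParity (algGrading 𝒲) 𝒲 p (φ ∘ₗ toSym 𝒲) :=
      zero_add p ▸ HasParity.comp hφ hasParity_toSym
    have h : TensorProduct.map (toSym 𝒲) (toSym 𝒲) ∘ₗ
          leibniz (parityAut 𝒲).toLinearMap p (fullExtend (φ ∘ₗ toSym 𝒲)) =
        leibniz (symSign 𝒲) p (extend 𝒲 φ) ∘ₗ TensorProduct.map (toSym 𝒲) (toSym 𝒲) :=
      TensorProduct.ext' fun a b => by
        simp [leibniz_tmul, extend_toSym, symSign_pow_toSym]
    refine LinearMap.ext fun x => ?_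
    simp only [LinearMap.comp_apply, diagonal, extend_apply,
      incl_toSym_of_aug_eq_zero (aug_fullExtend _ _), fullDiagonal_fullExtend hψ]
    exact LinearMap.congr_fun h _

end Extension

/-! ### Coderivations are determined by their degree-one component -/

section Uniqueness

variable {k : Type*} [CommRing k] {W : Type*} [AddCommGroup W] [Module k W]
  {𝒲 : ZMod 2 → Submodule k W} {n : ℕ} {p q : ZMod 2}

/-- The filtration of the unital symmetric algebra by word length: the `n`-th term is spanned by
the products of at most `n` elements of `W`. -/
def filtration (𝒲 : ZMod 2 → Submodule k W) (n : ℕ) : Submodule k (SymAlg 𝒲) :=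
  (1 ⊔ LinearMap.range (ι 𝒲)) ^ n

theorem mem_filtration_zero {x : SymAlg 𝒲} :
    x ∈ filtration 𝒲 0 ↔ ∃ c : k, c • (1 : SymAlg 𝒲) = x := by
  simp only [filtration, pow_zero, Submodule.mem_one, Algebra.algebraMap_eq_smul_one]

theorem filtration_le_succ (n : ℕ) : filtration 𝒲 n ≤ filtration 𝒲 (n + 1) := by
  rw [filtration, filtration, pow_succ']
  exact le_mul_of_one_le_left' le_sup_left

theorem filtration_mono : Monotone (filtration 𝒲) := monotone_nat_of_le_succ filtration_le_succ

theorem ι_mul_mem_filtration (w : W) {x : SymAlg 𝒲} (hx : x ∈ filtration 𝒲 n) :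
    ι 𝒲 w * x ∈ filtration 𝒲 (n + 1) := by
  rw [filtration, pow_succ']
  exact Submodule.mul_mem_mul (Submodule.mem_sup_right ⟨w, rfl⟩) hx

theorem filtration_succ_le {N : Submodule k (SymAlg 𝒲)} (le : filtration 𝒲 n ≤ N)
    (ι_mul : ∀ w, ∀ x ∈ filtration 𝒲 n, ι 𝒲 w * x ∈ N) : filtration 𝒲 (n + 1) ≤ N := by
  rw [filtration, pow_succ', Submodule.sup_mul, one_mul]
  refine sup_le le (Submodule.mul_le.2 ?_)
  rintro _ ⟨w, rfl⟩ x hx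
  exact ι_mul w x hx

theorem eq_zero_of_incl_mem_filtration_zero {y : Sym 𝒲} (hy : incl 𝒲 y ∈ filtration 𝒲 0) :
    y = 0 := by
  obtain ⟨c, hc⟩ := mem_filtration_zero.1 hy
  have hc₀ : c = 0 := by simpa [← hc] using aug_incl y
  rwa [hc₀, zero_smul, eq_comm, map_eq_zero_iff _ incl_injective] at hc

/-- The filtration of `SymAlg 𝒲 ⊗ SymAlg 𝒲` by the word length of the second factor. -/
def filtrationRight (𝒲 : ZMod 2 → Submodule k W) (n : ℕ) :
    Submodule k (SymAlg 𝒲 ⊗[k] SymAlg 𝒲) :=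
  LinearMap.range ((filtration 𝒲 n).subtype.lTensor (SymAlg 𝒲))

theorem tmul_mem_filtrationRight (a : SymAlg 𝒲) {b : SymAlg 𝒲} (hb : b ∈ filtration 𝒲 n) :
    a ⊗ₜ b ∈ filtrationRight 𝒲 n :=
  ⟨a ⊗ₜ ⟨b, hb⟩, rfl⟩

theorem filtrationRight_le {N : Submodule k (SymAlg 𝒲 ⊗[k] SymAlg 𝒲)}
    (tmul : ∀ a, ∀ b ∈ filtration 𝒲 n, a ⊗ₜ b ∈ N) : filtrationRight 𝒲 n ≤ N := by
  rintro _ ⟨z, rfl⟩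
  induction z using TensorProduct.induction_on with
  | zero => rw [map_zero]; exact zero_mem _
  | tmul a b => exact tmul a b b.2
  | add y z hy hz => rw [map_add]; exact add_mem hy hz

variable [DirectSum.Decomposition 𝒲]

theorem exists_mem_filtration (x : SymAlg 𝒲) : ∃ n, x ∈ filtration 𝒲 n := by
  induction x using SymAlg.induction with
  | one => exact ⟨0, mem_filtration_zero.2 ⟨1, one_smul k 1⟩⟩
  | add x y hx hy =>
    obtain ⟨m, hm⟩ := hx
    obtain ⟨n, hn⟩ := hy
    exact ⟨max m n, add_mem (filtration_mono (le_max_left m n) hm)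
      (filtration_mono (le_max_right m n) hn)⟩
  | smul c x hx =>
    obtain ⟨n, hn⟩ := hx
    exact ⟨n, Submodule.smul_mem _ c hn⟩
  | ι_mul _ w _ x hx =>
    obtain ⟨n, hn⟩ := hx
    exact ⟨n + 1, ι_mul_mem_filtration w hn⟩

theorem mulPrim_mem_filtrationRight (w : W) {z : SymAlg 𝒲 ⊗[k] SymAlg 𝒲}
    (hz : z ∈ filtrationRight 𝒲 n) : mulPrim 𝒲 w z ∈ filtrationRight 𝒲 (n + 1) := by
  refine filtrationRight_le (N := (filtrationRight 𝒲 (n + 1)).comap (mulPrim 𝒲 w))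
    (fun a b hb => ?_) hz
  rw [Submodule.mem_comap, mulPrim_tmul]
  exact add_mem (add_mem (tmul_mem_filtrationRight _ (filtration_le_succ n hb))
    (tmul_mem_filtrationRight _ (ι_mul_mem_filtration _ hb)))
    (tmul_mem_filtrationRight _ (ι_mul_mem_filtration _ hb))

theorem fullDiagonal_ι_mul_sub (w : W) (x : SymAlg 𝒲) :
    fullDiagonal 𝒲 (ι 𝒲 w * x) - 1 ⊗ₜ (ι 𝒲 w * x) =
      mulPrim 𝒲 w (fullDiagonal 𝒲 x - 1 ⊗ₜ x) + ι 𝒲 w ⊗ₜ x := by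
  have h : mulPrim 𝒲 w (1 ⊗ₜ x) = ι 𝒲 w ⊗ₜ x + 1 ⊗ₜ (ι 𝒲 w * x) := by
    rw [mulPrim_tmul, map_one, mul_one, add_assoc, ← TensorProduct.tmul_add, ← add_mul, ← map_add,
      proj_add_proj]
  rw [fullDiagonal_ι_mul, map_sub, h]
  abel

theorem fullDiagonal_sub_eq_zero {x : SymAlg 𝒲} (hx : x ∈ filtration 𝒲 0) :
    fullDiagonal 𝒲 x - 1 ⊗ₜ x = 0 := by
  obtain ⟨c, rfl⟩ := mem_filtration_zero.1 hx
  rw [map_smul, fullDiagonal_one, TensorProduct.tmul_smul, sub_self]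

theorem fullDiagonal_sub_mem {x : SymAlg 𝒲} (hx : x ∈ filtration 𝒲 (n + 1)) :
    fullDiagonal 𝒲 x - 1 ⊗ₜ x ∈ filtrationRight 𝒲 n := by
  suffices h : filtration 𝒲 (n + 1) ≤
      (filtrationRight 𝒲 n).comap (fullDiagonal 𝒲 - TensorProduct.mk k _ _ 1) from h hx
  clear hx
  induction n with
  | zero =>
    refine filtration_succ_le (fun x hx => ?_) (fun w x hx => ?_) <;>
      rw [Submodule.mem_comap, LinearMap.sub_apply, TensorProduct.mk_apply]
    · rw [fullDiagonal_sub_eq_zero hx]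
      exact zero_mem _
    · rw [fullDiagonal_ι_mul_sub, fullDiagonal_sub_eq_zero hx, map_zero, zero_add]
      exact tmul_mem_filtrationRight _ hx
  | succ n ih =>
    refine filtration_succ_le (fun x hx => ?_) (fun w x hx => ?_) <;>
      rw [Submodule.mem_comap, LinearMap.sub_apply, TensorProduct.mk_apply]
    · exact filtrationRight_le (fun a b hb =>
        tmul_mem_filtrationRight a (filtration_le_succ n hb)) (ih hx)
    · rw [fullDiagonal_ι_mul_sub]
      exact add_mem (mulPrim_mem_filtrationRight w (ih hx)) (tmul_mem_filtrationRight _ hx)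

theorem map_diagonal_eq_zero {Y Z : Type*} [AddCommGroup Y] [Module k Y] [AddCommGroup Z]
    [Module k Z] (f : Sym 𝒲 →ₗ[k] Y) {g : Sym 𝒲 →ₗ[k] Z}
    (hg : ∀ y, incl 𝒲 y ∈ filtration 𝒲 n → g y = 0) {y : Sym 𝒲}
    (hy : incl 𝒲 y ∈ filtration 𝒲 (n + 1)) : TensorProduct.map f g (diagonal 𝒲 y) = 0 := by
  have h : filtrationRight 𝒲 n ≤
      LinearMap.ker (TensorProduct.map (f ∘ₗ toSym 𝒲) (g ∘ₗ toSym 𝒲)) :=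
    filtrationRight_le fun a b hb => by
      have hb' : incl 𝒲 (toSym 𝒲 b) ∈ filtration 𝒲 n := by
        rw [incl_toSym, Algebra.algebraMap_eq_smul_one]
        exact sub_mem hb (filtration_mono n.zero_le (mem_filtration_zero.2 ⟨_, rfl⟩))
      simp [hg _ hb']
  have hker := h (fullDiagonal_sub_mem hy)
  rw [LinearMap.mem_ker, map_sub, TensorProduct.map_tmul, LinearMap.comp_apply, toSym_one, map_zero,
    TensorProduct.zero_tmul, sub_zero, TensorProduct.map_comp] at hker
  exact hker

theorem fullExtend_degreeOne_ι_mul (w : W) (x : SymAlg 𝒲) :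
    fullExtend (degreeOne 𝒲) (ι 𝒲 w * x) = ι 𝒲 w * x + ι 𝒲 w * fullExtend (degreeOne 𝒲) x := by
  have homogeneous {i : ZMod 2} {w : W} (hw : w ∈ 𝒲 i) : fullExtend (degreeOne 𝒲) (ι 𝒲 w * x) =
      ι 𝒲 w * x + ι 𝒲 w * fullExtend (degreeOne 𝒲) x := by
    have h : degreeOne 𝒲 ∘ₗ LinearMap.mulLeft k (ι 𝒲 w) = (aug 𝒲).toLinearMap.smulRight w :=
      LinearMap.ext fun x => degreeOne_ι_mul w x
    rw [fullExtend_ι_mul hasParity_degreeOne hw, h, fullExtend_smulRight_aug, sgn_zero_left,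
      one_smul]
  obtain ⟨a, ha, b, hb, rfl⟩ := isSignOperator_sign.exists_add_eq (𝒳 := 𝒲) w
  simp only [map_add, add_mul, homogeneous ha, homogeneous hb]
  abel

theorem fullExtend_degreeOne_eq_zero {x : SymAlg 𝒲} (hx : x ∈ filtration 𝒲 0) :
    fullExtend (degreeOne 𝒲) x = 0 := by
  obtain ⟨c, rfl⟩ := mem_filtration_zero.1 hx
  rw [map_smul, fullExtend_one, degreeOne_one, map_zero, smul_zero]

theorem fullExtend_degreeOne_sub_mem {x : SymAlg 𝒲} (hx : x ∈ filtration 𝒲 (n + 1)) :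
    fullExtend (degreeOne 𝒲) x - (n + 1) • x ∈ filtration 𝒲 n := by
  suffices h : filtration 𝒲 (n + 1) ≤
      (filtration 𝒲 n).comap (fullExtend (degreeOne 𝒲) - (n + 1) • LinearMap.id) from h hx
  clear hx
  induction n with
  | zero =>
    refine filtration_succ_le (fun x hx => ?_) (fun w x hx => ?_) <;>
      rw [Submodule.mem_comap, zero_add, one_smul, LinearMap.sub_apply, LinearMap.id_apply]
    · rw [fullExtend_degreeOne_eq_zero hx, zero_sub]
      exact neg_mem hx
    · rw [fullExtend_degreeOne_ι_mul, fullExtend_degreeOne_eq_zero hx, mul_zero, add_zero, sub_self]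
      exact zero_mem _
  | succ n ih =>
    refine filtration_succ_le (fun x hx => ?_) (fun w x hx => ?_) <;>
      rw [Submodule.mem_comap, add_smul, one_smul, LinearMap.sub_apply, LinearMap.add_apply,
        LinearMap.id_apply]
    · rw [← sub_sub]
      exact sub_mem (filtration_le_succ n (ih hx)) hx
    · have h := ι_mul_mem_filtration w (ih hx)
      rw [LinearMap.sub_apply, mul_sub] at h
      rw [fullExtend_degreeOne_ι_mul, add_comm (ι 𝒲 w * x), add_sub_add_right_eq_sub]
      simpa only [LinearMap.smul_apply, LinearMap.id_apply, mul_smul_comm] using h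

theorem incl_extend_toW (y : Sym 𝒲) :
    incl 𝒲 (extend 𝒲 (toW 𝒲) y) = fullExtend (degreeOne 𝒲) (incl 𝒲 y) := by
  rw [extend_apply, incl_toSym_of_aug_eq_zero (aug_fullExtend _ _), degreeOne]

theorem eq_zero_of_extend_toW [IsAddTorsionFree (Sym 𝒲)] {y : Sym 𝒲}
    (hy : extend 𝒲 (toW 𝒲) y = 0) : y = 0 := by
  obtain ⟨n, hn⟩ := exists_mem_filtration (incl 𝒲 y)
  induction n generalizing y with
  | zero => exact eq_zero_of_incl_mem_filtration_zero hn
  | succ n ih =>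
    have h := fullExtend_degreeOne_sub_mem hn
    rw [← incl_extend_toW, hy, map_zero, zero_sub, neg_mem_iff, ← map_nsmul] at h
    exact (nsmul_eq_zero_iff_right n.succ_ne_zero).1 (ih (by rw [map_nsmul, hy, smul_zero]) h)

theorem IsCoderivation.eq_zero [IsAddTorsionFree (Sym 𝒲)] {G : Sym 𝒲 →ₗ[k] Sym 𝒲}
    (hG : IsCoderivation 𝒲 p G) (h : toW 𝒲 ∘ₗ G = 0) : G = 0 := by
  suffices key : ∀ n y, incl 𝒲 y ∈ filtration 𝒲 n → G y = 0 from
    LinearMap.ext fun y => (exists_mem_filtration (incl 𝒲 y)).elim fun n hn => key n y hn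
  intro n
  induction n with
  | zero =>
    intro y hy
    rw [eq_zero_of_incl_mem_filtration_zero hy, map_zero]
  | succ n ih =>
    intro y hy
    have hΔ : diagonal 𝒲 (G y) = TensorProduct.map G LinearMap.id (diagonal 𝒲 y) +
        TensorProduct.map (symSign 𝒲 ^ p.val) G (diagonal 𝒲 y) :=
      LinearMap.congr_fun hG.diagonal_comp y
    refine eq_zero_of_extend_toW (incl_injective ?_)
    rw [map_zero, incl_extend, ← LinearMap.comp_apply (toW 𝒲), h, hΔ, map_diagonal_eq_zero _ ih hy,
      add_zero, ← LinearMap.comp_apply (TensorProduct.map _ _), ← TensorProduct.map_comp,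
      LinearMap.comp_assoc, h]
    simp

theorem IsCoderivation.sub {F G : Sym 𝒲 →ₗ[k] Sym 𝒲} (hF : IsCoderivation 𝒲 p F)
    (hG : IsCoderivation 𝒲 p G) : IsCoderivation 𝒲 p (F - G) where
  parity := hF.parity.sub hG.parity
  diagonal_comp := by
    change _ = leibniz (symSign 𝒲) p (F - G) ∘ₗ diagonal 𝒲
    rw [leibniz_sub, LinearMap.comp_sub, hF.diagonal_comp, hG.diagonal_comp]
    rfl

theorem IsCoderivation.commutator {F G : Sym 𝒲 →ₗ[k] Sym 𝒲} (hF : IsCoderivation 𝒲 p F)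
    (hG : IsCoderivation 𝒲 q G) : IsCoderivation 𝒲 (p + q) (commutator p q F G) where
  parity := hF.parity.commutator hG.parity
  diagonal_comp := by
    have hF' : diagonal 𝒲 ∘ₗ F = leibniz (symSign 𝒲) p F ∘ₗ diagonal 𝒲 := hF.diagonal_comp
    have hG' : diagonal 𝒲 ∘ₗ G = leibniz (symSign 𝒲) q G ∘ₗ diagonal 𝒲 := hG.diagonal_comp
    change _ = leibniz (symSign 𝒲) (p + q) (LInfinity.commutator p q F G) ∘ₗ diagonal 𝒲
    rw [leibniz_commutator isSignOperator_symSign hF.parity hG.parity]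
    simp only [LInfinity.commutator, LinearMap.comp_sub, LinearMap.sub_comp, LinearMap.comp_smul,
      LinearMap.smul_comp, ← LinearMap.comp_assoc, hF', hG']
    simp only [LinearMap.comp_assoc, hF', hG']

theorem IsCoderivation.toW_comp_mem {F : Sym 𝒲 →ₗ[k] Sym 𝒲} (hF : IsCoderivation 𝒲 p F) :
    toW 𝒲 ∘ₗ F ∈ cochains 𝒲 p :=
  add_zero p ▸ HasParity.comp toW_mem_cochains hF.parity

theorem toW_comp_commutator_extend (φ ψ : Cochain 𝒲) :
    toW 𝒲 ∘ₗ commutator p q (extend 𝒲 φ) (extend 𝒲 ψ) = bracket 𝒲 p q φ ψ := by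
  simp only [commutator, bracket, LinearMap.comp_sub, LinearMap.comp_smul, ← LinearMap.comp_assoc,
    toW_extend]

variable [IsAddTorsionFree (Sym 𝒲)]

theorem IsCoderivation.eq_of_toW_comp_eq {F G : Sym 𝒲 →ₗ[k] Sym 𝒲} (hF : IsCoderivation 𝒲 p F)
    (hG : IsCoderivation 𝒲 p G) (h : toW 𝒲 ∘ₗ F = toW 𝒲 ∘ₗ G) : F = G :=
  sub_eq_zero.1 ((hF.sub hG).eq_zero (by rw [LinearMap.comp_sub, h, sub_self]))

theorem IsCoderivation.extend_toW_comp {F : Sym 𝒲 →ₗ[k] Sym 𝒲} (hF : IsCoderivation 𝒲 p F) :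
    extend 𝒲 (toW 𝒲 ∘ₗ F) = F :=
  (isCoderivation_extend hF.toW_comp_mem).eq_of_toW_comp_eq hF (toW_extend _)

theorem extend_bracket {φ ψ : Cochain 𝒲} (hφ : φ ∈ cochains 𝒲 p) (hψ : ψ ∈ cochains 𝒲 q) :
    extend 𝒲 (bracket 𝒲 p q φ ψ) = commutator p q (extend 𝒲 φ) (extend 𝒲 ψ) := by
  rw [← toW_comp_commutator_extend]
  exact ((isCoderivation_extend hφ).commutator (isCoderivation_extend hψ)).extend_toW_comp

end Uniqueness

/-! ### Operators over `k[t]` -/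

section ParameterOperators

variable {k X : Type*} [CommRing k] [AddCommGroup X] [Module k X] {𝒳 : ZMod 2 → Submodule k X}
  {s : ZMod 2} {d f g : Module.End k X}

/-- The operator `f + t g` on `X[t]`, for `f` even: `(f + t g)(a + t b) = f a + t (g a + f b)`. -/
def tEven (f g : Module.End k X) : Module.End k (X × X) :=
  (f ∘ₗ LinearMap.fst k X X).prod (g ∘ₗ LinearMap.fst k X X + f ∘ₗ LinearMap.snd k X X)

theorem tEven_apply (x : X × X) : tEven f g x = (f x.1, g x.1 + f x.2) := rfl

theorem tOdd_apply (x : X × X) : tOdd s f g x = (f x.1, g x.1 + sgn k s 1 • f x.2) := rfl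

theorem fst_add_tMul_snd (x : X × X) : (x.1, 0) + tMul k X (x.2, 0) = x := by simp [tMul]

theorem eq_tEven {F : Module.End k (X × X)} (hF : ∀ x, F (tMul k X x) = tMul k X (F x)) :
    F = tEven (LinearMap.fst k X X ∘ₗ F ∘ₗ LinearMap.inl k X X)
      (LinearMap.snd k X X ∘ₗ F ∘ₗ LinearMap.inl k X X) :=
  LinearMap.ext fun x => by
    conv_lhs => rw [← fst_add_tMul_snd (k := k) x, map_add, hF]
    simp [tMul, tEven_apply, Prod.ext_iff]

theorem eq_tOdd {F : Module.End k (X × X)}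
    (hF : ∀ x, F (tMul k X x) = sgn k s 1 • tMul k X (F x)) :
    F = tOdd s (LinearMap.fst k X X ∘ₗ F ∘ₗ LinearMap.inl k X X)
      (LinearMap.snd k X X ∘ₗ F ∘ₗ LinearMap.inl k X X) :=
  LinearMap.ext fun x => by
    conv_lhs => rw [← fst_add_tMul_snd (k := k) x, map_add, hF]
    simp [tMul, tOdd_apply, Prod.ext_iff]

theorem tEven_tMul (x : X × X) : tEven f g (tMul k X x) = tMul k X (tEven f g x) := by
  simp [tMul, tEven_apply]

theorem tOdd_tMul (x : X × X) : tOdd s f g (tMul k X x) = sgn k s 1 • tMul k X (tOdd s f g x) := by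
  simp [tMul, tOdd_apply]

theorem hasParity_tEven_iff : HasParity (tGrading s 𝒳) (tGrading s 𝒳) 0 (tEven f g) ↔
    HasParity 𝒳 𝒳 0 f ∧ HasParity 𝒳 𝒳 s g := by
  refine ⟨fun h => ⟨fun i x hx => (h i (x, 0) ⟨hx, zero_mem _⟩).1, fun i x hx => ?_⟩,
    fun ⟨hf, hg⟩ i x hx => ⟨hf i _ hx.1, ?_⟩⟩
  · simpa [tEven_apply] using (h i (x, 0) ⟨hx, zero_mem _⟩).2
  · have h := hf _ _ hx.2
    rw [add_right_comm] at h
    have hg' := hg i _ hx.1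
    rw [← add_zero i] at hg'
    exact add_mem (by simpa using hg') h

theorem hasParity_tOdd_iff : HasParity (tGrading s 𝒳) (tGrading s 𝒳) 1 (tOdd s f g) ↔
    HasParity 𝒳 𝒳 1 f ∧ HasParity 𝒳 𝒳 (s + 1) g := by
  refine ⟨fun h => ⟨fun i x hx => (h i (x, 0) ⟨hx, zero_mem _⟩).1, fun i x hx => ?_⟩,
    fun ⟨hf, hg⟩ i x hx => ⟨hf i _ hx.1, ?_⟩⟩
  · have h := (h i (x, 0) ⟨hx, zero_mem _⟩).2
    rw [add_comm s, ← add_assoc]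
    simpa [tOdd_apply] using h
  · have hf' := hf _ _ hx.2
    have hg' := hg i _ hx.1
    rw [add_right_comm] at hf'
    rw [add_comm s, ← add_assoc] at hg'
    exact add_mem hg' (Submodule.smul_mem _ _ hf')

theorem tOdd_comp_self_eq_zero_iff :
    tOdd s d f ∘ₗ tOdd s d f = 0 ↔ d ∘ₗ d = 0 ∧ commutator (s + 1) 1 f d = 0 := by
  have hcomm (a : X) : commutator (s + 1) 1 f d a = f (d a) + sgn k s 1 • d (f a) := by
    simp [commutator, sgn_add_left, sgn_one_one]
  refine ⟨fun h => ⟨LinearMap.ext fun a => congrArg Prod.fst (LinearMap.congr_fun h (a, 0)),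
    LinearMap.ext fun a => ?_⟩, fun ⟨hd, hf⟩ => LinearMap.ext fun x => ?_⟩
  · rw [hcomm]
    simpa [tOdd_apply] using congrArg Prod.snd (LinearMap.congr_fun h (a, 0))
  · have hd' (a : X) : d (d a) = 0 := LinearMap.congr_fun hd a
    have hf' := hcomm x.1
    rw [hf, LinearMap.zero_apply] at hf'
    simp [tOdd_apply, hd', ← hf']

theorem bijective_tEven_iff : Function.Bijective (tEven f g) ↔ Function.Bijective f := by
  refine ⟨fun h => ⟨?_, fun y => ?_⟩, fun h => ⟨?_, fun y => ?_⟩⟩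
  · refine (injective_iff_map_eq_zero f).2 fun b hb => ?_
    have hb' : tEven f g (0, b) = tEven f g 0 := by simp [tEven_apply, hb]
    exact congrArg Prod.snd (h.1 hb')
  · obtain ⟨x, hx⟩ := h.2 (y, 0)
    exact ⟨x.1, congrArg Prod.fst hx⟩
  · refine (injective_iff_map_eq_zero (tEven f g)).2 fun x hx => ?_
    have h₁ : x.1 = 0 := (map_eq_zero_iff f h.1).1 (congrArg Prod.fst hx)
    have h₂ : g x.1 + f x.2 = 0 := congrArg Prod.snd hx
    rw [h₁, map_zero, zero_add, map_eq_zero_iff f h.1] at h₂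
    exact Prod.ext h₁ h₂
  · obtain ⟨a, ha⟩ := h.2 y.1
    obtain ⟨b, hb⟩ := h.2 (y.2 - g a)
    exact ⟨(a, b), Prod.ext ha (by simp [tEven_apply, hb])⟩

theorem tEven_comp_tOdd_eq_iff {g' : Module.End k X} {e : X ≃ₗ[k] X} :
    tEven e.toLinearMap (f ∘ₗ e.toLinearMap) ∘ₗ tOdd s d g =
        tOdd s d g' ∘ₗ tEven e.toLinearMap (f ∘ₗ e.toLinearMap) ↔
      e.toLinearMap ∘ₗ d = d ∘ₗ e.toLinearMap ∧ commutator s 1 f d = g' - e.conj g := by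
  have hcomm : commutator s 1 f d = g' - e.conj g ↔
      ∀ a, f (d (e a)) + e (g a) = g' (e a) + sgn k s 1 • d (f (e a)) := by
    rw [LinearMap.ext_iff, e.surjective.forall]
    refine forall_congr' fun a => ?_
    simp [commutator, sub_eq_sub_iff_add_eq_add, LinearEquiv.conj_apply]
  rw [hcomm]
  constructor
  · intro h
    have hd (a : X) : e (d a) = d (e a) := congrArg Prod.fst (LinearMap.congr_fun h (a, 0))
    refine ⟨LinearMap.ext hd, fun a => ?_⟩
    simpa [tEven_apply, tOdd_apply, hd] using congrArg Prod.snd (LinearMap.congr_fun h (a, 0))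
  · rintro ⟨hd, h⟩
    have hd' (a : X) : e (d a) = d (e a) := LinearMap.congr_fun hd a
    refine LinearMap.ext fun x => Prod.ext (hd' _) ?_
    simp only [LinearMap.comp_apply, tEven_apply, tOdd_apply, LinearEquiv.coe_coe, map_add,
      map_smul, smul_add, hd']
    rw [← add_assoc, h, add_assoc]

end ParameterOperators

/-! ### Codifferentials and automorphisms over `k[t]` -/

section ParameterCoalgebra

variable {k : Type*} [CommRing k] {W : Type*} [AddCommGroup W] [Module k W]
  {𝒲 : ZMod 2 → Submodule k W} [DirectSum.Decomposition 𝒲] {s : ZMod 2}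
  {d f : Module.End k (Sym 𝒲)}

theorem mapT_tmul (F G : SymT 𝒲 →ₗ[k] SymT 𝒲) (a b : Sym 𝒲) :
    mapT 𝒲 s F G (a ⊗ₜ b) = ((F (a, 0)).1 ⊗ₜ (G (b, 0)).1,
      (F (a, 0)).2 ⊗ₜ (G (b, 0)).1 + (symSign 𝒲 ^ s.val) (F (a, 0)).1 ⊗ₜ (G (b, 0)).2) := by
  simp only [mapT, TensorProduct.lift.tmul, LinearMap.compl₁₂_apply, LinearMap.comp_apply,
    LinearMap.inl_apply]
  rfl

theorem mapT_tOdd_add (z : Sym 𝒲 ⊗[k] Sym 𝒲) :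
    (mapT 𝒲 s (tOdd s d f) LinearMap.id + mapT 𝒲 s (signT 𝒲 s) (tOdd s d f)) z =
      (leibniz (symSign 𝒲) 1 d z, leibniz (symSign 𝒲) (s + 1) f z) := by
  induction z using TensorProduct.induction_on with
  | zero => simp only [map_zero, Prod.mk_zero_zero]
  | add y z hy hz => simp only [map_add, hy, hz, Prod.mk_add_mk]
  | tmul a b =>
    simp [mapT_tmul, leibniz_tmul, tOdd_apply, signT, isSignOperator_symSign.pow_add, ZMod.val_one]

theorem mapT_tEven (e : Sym 𝒲 ≃ₗ[k] Sym 𝒲) (z : Sym 𝒲 ⊗[k] Sym 𝒲) :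
    mapT 𝒲 s (tEven e.toLinearMap (f ∘ₗ e.toLinearMap))
        (tEven e.toLinearMap (f ∘ₗ e.toLinearMap)) z =
      (TensorProduct.map e.toLinearMap e.toLinearMap z,
        leibniz (symSign 𝒲) s f (TensorProduct.map e.toLinearMap e.toLinearMap z)) := by
  induction z using TensorProduct.induction_on with
  | zero => simp only [map_zero, Prod.mk_zero_zero]
  | add y z hy hz => simp only [map_add, hy, hz, Prod.mk_add_mk]
  | tmul a b => simp [mapT_tmul, leibniz_tmul, tEven_apply]

theorem isOddCodifferentialT_tOdd_iff : IsOddCodifferentialT 𝒲 s (tOdd s d f) ↔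
    (IsCoderivation 𝒲 1 d ∧ d ∘ₗ d = 0) ∧
      IsCoderivation 𝒲 (s + 1) f ∧ commutator (s + 1) 1 f d = 0 := by
  have hdiagonal : (∀ a, diagonalT 𝒲 (tOdd s d f (a, 0)) = (mapT 𝒲 s (tOdd s d f) LinearMap.id +
      mapT 𝒲 s (signT 𝒲 s) (tOdd s d f)) (diagonal 𝒲 a)) ↔
      diagonal 𝒲 ∘ₗ d = leibniz (symSign 𝒲) 1 d ∘ₗ diagonal 𝒲 ∧
        diagonal 𝒲 ∘ₗ f = leibniz (symSign 𝒲) (s + 1) f ∘ₗ diagonal 𝒲 := by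
    simp only [mapT_tOdd_add, LinearMap.ext_iff, ← forall_and]
    simp [diagonalT, tOdd_apply]
  constructor
  · intro h
    have hp := hasParity_tOdd_iff.1 h.parity
    have hΔ := hdiagonal.1 h.diagonal_comp
    have hsq := tOdd_comp_self_eq_zero_iff.1 h.comp_self
    exact ⟨⟨⟨hp.1, hΔ.1⟩, hsq.1⟩, ⟨hp.2, hΔ.2⟩, hsq.2⟩
  · rintro ⟨⟨hd, hdd⟩, hf, hcomm⟩
    exact ⟨hasParity_tOdd_iff.2 ⟨hd.parity, hf.parity⟩, tOdd_tMul,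
      hdiagonal.2 ⟨hd.diagonal_comp, hf.diagonal_comp⟩,
      tOdd_comp_self_eq_zero_iff.2 ⟨hdd, hcomm⟩⟩

theorem isAutomorphismT_tEven_iff [IsAddTorsionFree (Sym 𝒲)] {e : Sym 𝒲 ≃ₗ[k] Sym 𝒲} :
    IsAutomorphismT 𝒲 s (tEven e.toLinearMap (f ∘ₗ e.toLinearMap)) ↔
      (HasParity (symGrading 𝒲) (symGrading 𝒲) 0 e.toLinearMap ∧ diagonal 𝒲 ∘ₗ e.toLinearMap =
        TensorProduct.map e.toLinearMap e.toLinearMap ∘ₗ diagonal 𝒲) ∧ IsCoderivation 𝒲 s f := by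
  have hdiagonal : (∀ a, diagonalT 𝒲 (tEven e.toLinearMap (f ∘ₗ e.toLinearMap) (a, 0)) =
      mapT 𝒲 s (tEven e.toLinearMap (f ∘ₗ e.toLinearMap))
        (tEven e.toLinearMap (f ∘ₗ e.toLinearMap)) (diagonal 𝒲 a)) ↔
      diagonal 𝒲 ∘ₗ e.toLinearMap =
          TensorProduct.map e.toLinearMap e.toLinearMap ∘ₗ diagonal 𝒲 ∧
        diagonal 𝒲 ∘ₗ f = leibniz (symSign 𝒲) s f ∘ₗ diagonal 𝒲 := by
    simp only [mapT_tEven, LinearMap.ext_iff, diagonalT, LinearMap.prodMap_apply, tEven_apply,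
      Prod.mk.injEq, forall_and, map_zero, add_zero, LinearMap.comp_apply, LinearEquiv.coe_coe]
    refine and_congr_right fun he => ?_
    simp only [← he]
    exact (e.surjective.forall (p := fun b =>
      diagonal 𝒲 (f b) = leibniz (symSign 𝒲) s f (diagonal 𝒲 b))).symm
  constructor
  · intro h
    obtain ⟨he, hf⟩ := hasParity_tEven_iff.1 h.parity
    obtain ⟨heΔ, hfΔ⟩ := hdiagonal.1 h.diagonal_comp
    have he' := isSignOperator_symSign.hasParity_symm isSignOperator_symSign he
    refine ⟨⟨he, heΔ⟩, ⟨?_, hfΔ⟩⟩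
    simpa [LinearMap.comp_assoc] using hf.comp he'
  · rintro ⟨⟨he, heΔ⟩, hf⟩
    refine ⟨hasParity_tEven_iff.2 ⟨he, ?_⟩, tEven_tMul, hdiagonal.2 ⟨heΔ, hf.diagonal_comp⟩,
      bijective_tEven_iff.2 e.bijective⟩
    simpa using hf.parity.comp he

theorem IsAutomorphismT.exists_eq_tEven [IsAddTorsionFree (Sym 𝒲)] {Φ : SymT 𝒲 →ₗ[k] SymT 𝒲}
    (h : IsAutomorphismT 𝒲 s Φ) : ∃ (e : Sym 𝒲 ≃ₗ[k] Sym 𝒲) (f : Module.End k (Sym 𝒲)),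
      IsCoderivation 𝒲 s f ∧ Φ = tEven e.toLinearMap (f ∘ₗ e.toLinearMap) := by
  have hbij := h.bijective
  rw [eq_tEven h.map_tMul, bijective_tEven_iff] at hbij
  let e := LinearEquiv.ofBijective _ hbij
  let f := (LinearMap.snd k _ _ ∘ₗ Φ ∘ₗ LinearMap.inl k _ _) ∘ₗ e.symm.toLinearMap
  have hf : f ∘ₗ e.toLinearMap = LinearMap.snd k _ _ ∘ₗ Φ ∘ₗ LinearMap.inl k _ _ := by
    rw [LinearMap.comp_assoc, e.symm_comp, LinearMap.comp_id]
  have hΦ : Φ = tEven e.toLinearMap (f ∘ₗ e.toLinearMap) := hf ▸ eq_tEven h.map_tMul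
  exact ⟨e, f, (isAutomorphismT_tEven_iff.1 (hΦ ▸ h)).2, hΦ⟩

end ParameterCoalgebra

/-! ### Cohomology and infinitesimal deformations -/

namespace LInfinityStructure

variable {k : Type*} [CommRing k] {V : Type*} [AddCommGroup V] [Module k V]
  {𝒱 : ZMod 2 → Submodule k V} [DirectSum.Decomposition 𝒱] {L : LInfinityStructure 𝒱}
  {p s : ZMod 2} {φ δ δ' : Cochain (parityRev 𝒱)} {F : SymT (parityRev 𝒱) →ₗ[k] SymT (parityRev 𝒱)}

theorem deform_injective (s : ZMod 2) : Function.Injective (L.deform s) := fun δ δ' h => by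
  rw [← toW_extend δ, ← toW_extend δ']
  congr 1
  refine LinearMap.ext fun a => ?_
  simpa [deform, tOdd_apply] using congrArg Prod.snd (LinearMap.congr_fun h (a, 0))

variable [IsAddTorsionFree (Sym (parityRev 𝒱))]

theorem extend_l : extend (parityRev 𝒱) L.l = L.d := L.isCoderivation.extend_toW_comp

theorem extend_D (hφ : φ ∈ cochains (parityRev 𝒱) p) :
    extend (parityRev 𝒱) (L.D p φ) = commutator p 1 (extend (parityRev 𝒱) φ) L.d :=
  (extend_bracket hφ L.isCoderivation.toW_comp_mem).trans (by rw [← l, extend_l])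

theorem D_eq_zero_iff (hφ : φ ∈ cochains (parityRev 𝒱) p) :
    L.D p φ = 0 ↔ commutator p 1 (extend (parityRev 𝒱) φ) L.d = 0 := by
  rw [← extend_D hφ]
  exact ⟨fun h => by rw [h, map_zero], fun h => by
    rw [← toW_extend (L.D p φ), h, LinearMap.comp_zero]⟩

theorem D_mem (hφ : φ ∈ cochains (parityRev 𝒱) p) : L.D p φ ∈ cochains (parityRev 𝒱) (p + 1) := by
  rw [← toW_extend (L.D p φ), extend_D hφ]
  exact ((isCoderivation_extend hφ).commutator L.isCoderivation).toW_comp_mem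

theorem D_D (hφ : φ ∈ cochains (parityRev 𝒱) p) : L.D (p + 1) (L.D p φ) = 0 := by
  have hdd (a : Sym (parityRev 𝒱)) : L.d (L.d a) = 0 := LinearMap.congr_fun L.comp_self a
  rw [D_eq_zero_iff (D_mem hφ), extend_D hφ]
  exact LinearMap.ext fun x => by simp [commutator, hdd, sgn_add_left, sgn_one_one]

theorem coboundaries_le_cocycles (L : LInfinityStructure 𝒱) (p : ZMod 2) :
    L.coboundaries p ≤ L.cocycles p := by
  rintro _ ⟨φ, hφ, rfl⟩
  have hmem := D_mem (L := L) hφ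
  have hD := D_D (L := L) hφ
  rw [add_assoc, CharTwo.add_self_eq_zero, add_zero] at hmem hD
  exact ⟨hmem, hD⟩

theorem mem_coboundaries_iff : δ ∈ L.coboundaries (s + 1) ↔
    ∃ f, IsCoderivation (parityRev 𝒱) s f ∧ commutator s 1 f L.d = extend (parityRev 𝒱) δ := by
  rw [coboundaries, add_assoc, CharTwo.add_self_eq_zero, add_zero, Submodule.mem_map]
  constructor
  · rintro ⟨φ, hφ, rfl⟩
    exact ⟨_, isCoderivation_extend hφ, (extend_D hφ).symm⟩
  · rintro ⟨f, hf, h⟩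
    refine ⟨_, hf.toW_comp_mem, ?_⟩
    rw [← toW_extend (L.D s _), extend_D hf.toW_comp_mem, hf.extend_toW_comp, h, toW_extend]

theorem isInfinitesimalDeformation_deform_iff (hδ : δ ∈ cochains (parityRev 𝒱) (s + 1)) :
    L.IsInfinitesimalDeformation s (L.deform s δ) ↔ δ ∈ L.cocycles (s + 1) := by
  have h : IsOddCodifferentialT (parityRev 𝒱) s (L.deform s δ) ↔ _ := isOddCodifferentialT_tOdd_iff
  rw [cocycles, Submodule.mem_inf, LinearMap.mem_ker, D_eq_zero_iff hδ]
  exact ⟨fun hF => ⟨hδ, (h.1 hF.isOddCodifferentialT).2.2⟩, fun hF =>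
    ⟨h.2 ⟨⟨L.isCoderivation, L.comp_self⟩, isCoderivation_extend hδ, hF.2⟩, fun _ => rfl⟩⟩

theorem IsInfinitesimalDeformation.exists_deform (hF : L.IsInfinitesimalDeformation s F) :
    ∃ δ ∈ L.cocycles (s + 1), F = L.deform s δ := by
  have hd : LinearMap.fst k _ _ ∘ₗ F ∘ₗ LinearMap.inl k _ _ = L.d := LinearMap.ext hF.reduction
  have hFt := eq_tOdd hF.isOddCodifferentialT.map_tMul
  rw [hd] at hFt
  have hf := (isOddCodifferentialT_tOdd_iff.1 (hFt ▸ hF.isOddCodifferentialT)).2.1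
  have hδ : F = L.deform s _ := hFt.trans (by rw [← hf.extend_toW_comp]; rfl)
  exact ⟨_, (isInfinitesimalDeformation_deform_iff hf.toW_comp_mem).1 (hδ ▸ hF), hδ⟩

theorem equivalentDeformations_deform_iff :
    EquivalentDeformations (parityRev 𝒱) s (L.deform s δ) (L.deform s δ') ↔
      δ' - δ ∈ L.coboundaries (s + 1) := by
  rw [mem_coboundaries_iff, map_sub]
  constructor
  · rintro ⟨Φ, hΦ, hid, h⟩
    obtain ⟨e, f, hf, rfl⟩ := hΦ.exists_eq_tEven
    obtain rfl : e = LinearEquiv.refl k _ := LinearEquiv.ext hid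
    exact ⟨f, hf, (tEven_comp_tOdd_eq_iff.1 h).2⟩
  · rintro ⟨f, hf, h⟩
    have hid : IsAutomorphismT (parityRev 𝒱) s (tEven (LinearEquiv.refl k _).toLinearMap
        (f ∘ₗ (LinearEquiv.refl k _).toLinearMap)) :=
      isAutomorphismT_tEven_iff.2 ⟨⟨fun i x hx => by simpa using hx, by simp⟩, hf⟩
    exact ⟨_, hid, fun _ => rfl, tEven_comp_tOdd_eq_iff.2 ⟨rfl, h⟩⟩

theorem isTrivialDeformation_deform_iff :
    L.IsTrivialDeformation s (L.deform s δ) ↔ δ ∈ L.coboundaries (s + 1) := by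
  constructor
  · rintro ⟨Φ, hΦ, h⟩
    obtain ⟨e, f, hf, rfl⟩ := hΦ.exists_eq_tEven
    refine mem_coboundaries_iff.2 ⟨f, hf, ?_⟩
    simpa using (tEven_comp_tOdd_eq_iff.1 h).2
  · intro h
    rw [← sub_zero δ, ← equivalentDeformations_deform_iff] at h
    obtain ⟨Φ, hΦ, -, h⟩ := h
    exact ⟨Φ, hΦ, by simpa using h⟩

/-- The correspondence `δ ↦ d + t δ̂` between the cocycles of parity `s + 1` and the infinitesimal
deformations with a parameter of parity `s`. -/
def deformationEquiv (L : LInfinityStructure 𝒱) (s : ZMod 2) :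
    L.cocycles (s + 1) ≃ {F // L.IsInfinitesimalDeformation s F} :=
  Equiv.ofBijective
    (fun δ => ⟨L.deform s δ, (isInfinitesimalDeformation_deform_iff δ.2.1).2 δ.2⟩)
    ⟨fun _ _ h => Subtype.ext (deform_injective s (congrArg Subtype.val h)), fun F =>
      let ⟨δ, hδ, h⟩ := F.2.exists_deform
      ⟨⟨δ, hδ⟩, Subtype.ext h.symm⟩⟩

/-- The cohomology class `[δ]` of an infinitesimal deformation `d + t δ̂`. -/
def deformationClass (L : LInfinityStructure 𝒱) (s : ZMod 2)
    (F : {F // L.IsInfinitesimalDeformation s F}) : L.H (s + 1) :=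
  Submodule.Quotient.mk ((L.deformationEquiv s).symm F)

theorem deformationClass_eq {F : {F // L.IsInfinitesimalDeformation s F}}
    {δ : L.cocycles (s + 1)} (h : F.1 = L.deform s δ) :
    L.deformationClass s F = Submodule.Quotient.mk δ :=
  congrArg _ ((L.deformationEquiv s).symm_apply_eq.2 (Subtype.ext h))

theorem deformationClass_surjective : Function.Surjective (L.deformationClass s) :=
  (Submodule.Quotient.mk_surjective _).comp (L.deformationEquiv s).symm.surjective

theorem deformationClass_eq_iff {F F' : {F // L.IsInfinitesimalDeformation s F}} :
    L.deformationClass s F = L.deformationClass s F' ↔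
      EquivalentDeformations (parityRev 𝒱) s F.1 F'.1 := by
  obtain ⟨δ, rfl⟩ := (L.deformationEquiv s).surjective F
  obtain ⟨δ', rfl⟩ := (L.deformationEquiv s).surjective F'
  rw [deformationClass_eq rfl, deformationClass_eq rfl, eq_comm, Submodule.Quotient.eq]
  exact equivalentDeformations_deform_iff.symm

end LInfinityStructure

end

end LInfinity

open LInfinity LInfinityStructure in
theorem mainTheorem4_general {k : Type*} [CommRing k] {V : Type*} [AddCommGroup V]
    [Module k V] (𝒱 : ZMod 2 → Submodule k V) [DirectSum.Decomposition 𝒱]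
    [IsAddTorsionFree (Sym (parityRev 𝒱))] (L : LInfinityStructure 𝒱) :
    (∀ p : ZMod 2, L.coboundaries p ≤ L.cocycles p) ∧
    ∀ s : ZMod 2,
      (∀ δ ∈ cochains (parityRev 𝒱) (s + 1),
        L.IsInfinitesimalDeformation s (L.deform s δ) ↔ δ ∈ L.cocycles (s + 1)) ∧
      (∀ F, L.IsInfinitesimalDeformation s F →
        ∃! δ, δ ∈ cochains (parityRev 𝒱) (s + 1) ∧ F = L.deform s δ) ∧
      (∀ δ ∈ cochains (parityRev 𝒱) (s + 1),
        L.IsTrivialDeformation s (L.deform s δ) ↔ δ ∈ L.coboundaries (s + 1)) ∧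
      ∃ cls : {F // L.IsInfinitesimalDeformation s F} → L.H (s + 1),
        (∀ (F : {F // L.IsInfinitesimalDeformation s F}) (δ : L.cocycles (s + 1)),
          F.1 = L.deform s δ → cls F = Submodule.Quotient.mk δ) ∧
        Function.Surjective cls ∧
        ∀ F F' : {F // L.IsInfinitesimalDeformation s F},
          cls F = cls F' ↔ EquivalentDeformations (parityRev 𝒱) s F.1 F'.1 := by
  refine ⟨L.coboundaries_le_cocycles, fun s => ⟨fun δ hδ =>
    isInfinitesimalDeformation_deform_iff hδ, fun F hF => ?_,
    fun _ _ => isTrivialDeformation_deform_iff, L.deformationClass s,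
    fun _ _ => deformationClass_eq,
    deformationClass_surjective,
    fun _ _ => deformationClass_eq_iff⟩⟩
  obtain ⟨δ, hδ, rfl⟩ := hF.exists_deform
  exact ⟨δ, ⟨hδ.1, rfl⟩, fun δ' h => deform_injective s h.2.symm⟩

theorem mainTheorem4 {k : Type*} [CommRing k] [Algebra ℚ k] {V : Type*} [AddCommGroup V]
    [Module k V] (𝒱 : ZMod 2 → Submodule k V) [DirectSum.Decomposition 𝒱]
    (L : LInfinity.LInfinityStructure 𝒱) :
    -- `D` is a differential
    (∀ p : ZMod 2, L.coboundaries p ≤ L.cocycles p) ∧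
    -- for a parameter `t` of either parity `s`
    ∀ s : ZMod 2,
      -- `d + t δ` is an infinitesimal deformation if and only if `δ` is a cocycle
      (∀ δ ∈ LInfinity.cochains (LInfinity.parityRev 𝒱) (s + 1),
        L.IsInfinitesimalDeformation s (L.deform s δ) ↔ δ ∈ L.cocycles (s + 1)) ∧
      -- every infinitesimal deformation has this form, for a unique `δ`
      (∀ F, L.IsInfinitesimalDeformation s F →
        ∃! δ, δ ∈ LInfinity.cochains (LInfinity.parityRev 𝒱) (s + 1) ∧ F = L.deform s δ) ∧
      -- `d + t δ` is trivial if and only if `δ` is a coboundary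
      (∀ δ ∈ LInfinity.cochains (LInfinity.parityRev 𝒱) (s + 1),
        L.IsTrivialDeformation s (L.deform s δ) ↔ δ ∈ L.coboundaries (s + 1)) ∧
      -- `d + t δ ↦ [δ]` is a bijection from the equivalence classes to the cohomology
      ∃ cls : {F // L.IsInfinitesimalDeformation s F} → L.H (s + 1),
        (∀ (F : {F // L.IsInfinitesimalDeformation s F}) (δ : L.cocycles (s + 1)),
          F.1 = L.deform s δ → cls F = Submodule.Quotient.mk δ) ∧
        Function.Surjective cls ∧
        ∀ F F' : {F // L.IsInfinitesimalDeformation s F},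
          cls F = cls F' ↔
            LInfinity.EquivalentDeformations (LInfinity.parityRev 𝒱) s F.1 F'.1 := by
  let _ : Module ℚ (LInfinity.Sym (LInfinity.parityRev 𝒱)) := Module.compHom _ (algebraMap ℚ k)
  have := IsAddTorsionFree.of_module_rat (LInfinity.Sym (LInfinity.parityRev 𝒱))
  exact mainTheorem4_general 𝒱 L
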